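/- Let $r\ge 3$ be an odd integer, $\mathbb L=\mathbb F_{2^r}(t)$ the field of rational functions over $\mathbb F_{2^r}$, and let $\sigma=\theta\circ\tau$, where $\tau$ is the Frobenius map $a\mapsto a^2$ applied to the coefficients (so $\tau(t)=t$) and $\theta$ is the $\mathbb F_{2^r}$-automorphism $t\mapsto 1/t$ of $\mathbb L$. Put $s=t+\theta(t)=t+1/t$, $\mathbb K=\mathbb F_2(s)$ (the fixed field of $\sigma$) and $\mathbb L'=\mathbb F_{2^r}(s)$ (so $[\mathbb L:\mathbb L']=2$). Let $R=\mathbb L[x;\sigma]$ be the skew polynomial ring with $xa=\sigma(a)x$ for $a \in \mathbb L$, let $f=x^2+f_0\in R$ with $f_0=\frac{t^2+1}{t^2+t+1}$, and regard $R/Rf$ as a $\mathbb K$-vector space. Its elements are the classes of the polynomials $b_0+b_1x$ with $b_0,b_1\in\mathbb L$. Let $\eta\in\mathbb L$ with $\mathrm N_{\mathbb L/\mathbb K}(\eta f_0)\neq 1$, and let $\gamma\in\mathbb L$ with $\gamma/f_0\notin\mathbb L'$ and $\mathrm N_{\mathbb L/\mathbb K}(\gamma)$ not a square in $\mathbb K$.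 On $R/Rf$ consider the multiplications $$\bigl((a_0-\eta a_0f_0)+a_1x\bigr)\star_S(b_0+b_1x)=\bigl((a_0-\eta a_0f_0)+a_1x+\eta a_0f\bigr)(b_0+b_1x)\bmod Rf,$$ for $a_0,a_1,b_0,b_1\in\mathbb L$, and $$\bigl((a_0'+\gamma a_0'')+a_1x\bigr)\star_D(b_0+b_1x)=\Bigl((a_0'+\gamma a_0'')+a_1x-\tfrac{\gamma}{f_0}a_0''f\Bigr)(b_0+b_1x)\bmod Rf,$$ for $a_0',a_0''\in\mathbb L'$ and $a_1,b_0,b_1\in\mathbb L$, and the Petit multiplication $(a_0+a_1x)\circ(b_0+b_1x)=(a_0+a_1x)(b_0+b_1x)\bmod Rf$, for $a_0,a_1,b_0,b_1\in\mathbb L$. Here a division algebra over $\mathbb K$ is a nonzero finite-dimensional $\mathbb K$-vector space with a $\mathbb K$-bilinear multiplication for which left and right multiplication by every nonzero element are bijective. The right nucleus of $(A,\star)$ is $\mathbb N_r(A)=\{c\in A: a\star(b\star c)=(a\star b)\star c\ \text{for all } a,b\in A\}$. Two algebras $(A,\star)$ and $(A',\star')$ are $\mathbb K$-isotopic if there are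 $\mathbb K$-linear bijections $h_1,h_2,h_3:A\to A'$ with $h_1(a\star b)=h_2(a)\star' h_3(b)$ for all $a,b\in A$. **Theorem.** Each of these three formulas determines a unique $\mathbb K$-bilinear multiplication on $R/Rf$, and: 1. $(R/Rf,\star_S)$ and $(R/Rf,\star_D)$ are division algebras over $\mathbb K$, and neither is associative. 2. The right nucleus of each of them, with the induced multiplication, is an associative unital central division algebra over $\mathbb K$ of degree $2$ (that is, of dimension $4$ over its centre $\mathbb K$); in particular it is not commutative. The right nucleus of every unital $\mathbb K$-algebra that is $\mathbb K$-isotopic to $(R/Rf,\star_S)$ is likewise a central division algebra over $\mathbb K$ of degree $2$. 3. $(R/Rf,\star_S)$ and $(R/Rf,\star_D)$ are not $\mathbb K$-isotopic to each other. The algebra $(R/Rf,\star_D)$ is not $\mathbb K$-isotopic to the Petit algebra $(R/Rf,\circ)$, and if $\eta\neq 0$ then $(R/Rf,\star_S)$ is not $\mathbb K$-isotopic to the Petit algebra $(R/Rf,\circ)$ either. -/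

import Mathlib

open scoped nonZeroDivisors

namespace SkewQuotient

/-! ### Nonassociative algebras, given by a bilinear multiplication on a vector space -/

section NonassociativeAlgebra

universe u v w

variable {K : Type w} [Field K] {A : Type u} [AddCommGroup A] [Module K A]
  {B : Type v} [AddCommGroup B] [Module K B]

/-- A (not necessarily associative, not necessarily unital) finite-dimensional division algebra:
left and right multiplication by every nonzero element are invertible. -/
def IsDivisionAlgebra (m : A →ₗ[K] A →ₗ[K] A) : Prop :=
  FiniteDimensional K A ∧ Nontrivial A ∧
    ∀ a : A, a ≠ 0 → Function.Bijective (m a) ∧ Function.Bijective (m.flip a)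

/-- The multiplication `m` is associative. -/
def IsAssociative (m : A →ₗ[K] A →ₗ[K] A) : Prop :=
  ∀ a b c : A, m (m a b) c = m a (m b c)

/-- The multiplication `m` has a two-sided identity. -/
def IsUnital (m : A →ₗ[K] A →ₗ[K] A) : Prop :=
  ∃ e : A, ∀ a : A, m e a = a ∧ m a e = a

/-- The right nucleus: all `c` with `a (b c) = (a b) c` for all `a` and `b`. -/
def rightNucleus (m : A →ₗ[K] A →ₗ[K] A) : Submodule K A where
  carrier := {c | ∀ a b : A, m a (m b c) = m (m a b) c}
  add_mem' := by
    intro x y hx hy a b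
    simp only [map_add, hx a b, hy a b]
  zero_mem' := by
    intro a b
    simp only [map_zero]
  smul_mem' := by
    intro k x hx a b
    simp only [map_smul, hx a b]

/-- The subspace `N`, with the multiplication `m` restricted to it, is a central division algebra
over `K` (associative and unital) of degree `d`, that is, of dimension `d ^ 2`. -/
def IsCentralDivisionOfDegree (m : A →ₗ[K] A →ₗ[K] A) (N : Submodule K A) (d : ℕ) : Prop :=
  ∃ (D : Type u) (_ : DivisionRing D) (_ : Algebra K D) (e : D ≃ₗ[K] N),
    Algebra.IsCentral K D ∧ Module.finrank K D = d ^ 2 ∧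
      ∀ x y : D, (e (x * y) : A) = m (e x) (e y)

/-- `K`-isotopy of two `K`-algebras. -/
def KIsotopic (m : A →ₗ[K] A →ₗ[K] A) (m' : B →ₗ[K] B →ₗ[K] B) : Prop :=
  ∃ h₁ h₂ h₃ : A ≃ₗ[K] B, ∀ a b : A, h₁ (m a b) = m' (h₂ a) (h₃ b)

end NonassociativeAlgebra

/-! ### The function field and its automorphism -/

noncomputable section

/-- The field `𝔽_{2^r}` of constants. -/
abbrev Fq (r : ℕ) : Type := GaloisField 2 r

/-- The field `L = 𝔽_{2^r}(t)` of rational functions. -/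
abbrev L (r : ℕ) : Type := RatFunc (Fq r)

/-- The indeterminate `t` of `L`. -/
def t (r : ℕ) : L r := RatFunc.X

/-- The coefficientwise Frobenius map of `L`: it squares the constants and fixes `t`. -/
def τ (r : ℕ) : L r →+* L r :=
  RatFunc.mapRingHom (Polynomial.mapRingHom (frobenius (Fq r) 2))
    (nonZeroDivisors_le_comap_nonZeroDivisors_of_injective _
      (Polynomial.map_injective _ (frobenius (Fq r) 2).injective))

theorem transcendental_t_inv (r : ℕ) : Transcendental (Fq r) (t r)⁻¹ := fun h =>
  RatFunc.transcendental_X (K := Fq r) (by simpa [t] using h.inv)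

/-- The substitution `t ↦ 1 / t`, which fixes the constants. -/
def θ (r : ℕ) : L r →ₐ[Fq r] L r :=
  RatFunc.liftAlgHom (Polynomial.aeval (t r)⁻¹)
    (nonZeroDivisors_le_comap_nonZeroDivisors_of_injective _
      (transcendental_iff_injective.mp (transcendental_t_inv r)))

/-- `σ = θ ∘ τ`. -/
def σ (r : ℕ) : L r →+* L r := (θ r : L r →+* L r).comp (τ r)

/-- `s = t + θ(t) = t + 1 / t`. -/
def s (r : ℕ) : L r := t r + θ r (t r)

/-- The field `K = 𝔽₂(s)`. -/
abbrev K (r : ℕ) : IntermediateField (ZMod 2) (L r) := IntermediateField.adjoin (ZMod 2) {s r}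

/-- The field `L' = 𝔽_{2^r}(s)`. -/
abbrev L' (r : ℕ) : IntermediateField (Fq r) (L r) := IntermediateField.adjoin (Fq r) {s r}

/-! ### The skew polynomial ring `R = L[x; σ]` and the quotient `R / R f` -/

/-- The action of `ℕ` on `L` through the powers of `σ`; with it Mathlib's `SkewPolynomial (L r)`
is `L[x; σ]`, with `x a = σ(a) x`. -/
instance instSkewAction (r : ℕ) : MulSemiringAction (Multiplicative ℕ) (L r) where
  smul n a := (σ r)^[n.toAdd] a
  one_smul _ := rfl
  mul_smul m n a := Function.iterate_add_apply (σ r) m.toAdd n.toAdd a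
  smul_zero n := iterate_map_zero (σ r) n.toAdd
  smul_add n a b := iterate_map_add (σ r) n.toAdd a b
  smul_one n := iterate_map_one (σ r) n.toAdd
  smul_mul n a b := iterate_map_mul (σ r) n.toAdd a b

/-- The skew polynomial ring `R = L[x; σ]`. -/
abbrev R (r : ℕ) : Type := SkewPolynomial (L r)

/-- The skew polynomial `c₀ + c₁ x`. -/
def lin {r : ℕ} (c₀ c₁ : L r) : R r :=
  SkewPolynomial.C c₀ + SkewPolynomial.C c₁ * SkewPolynomial.X

/-- The constant coefficient `f₀ = (t² + 1) / (t² + t + 1)` of `f`. -/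
def f₀ (r : ℕ) : L r := (t r ^ 2 + 1) / (t r ^ 2 + t r + 1)

/-- The skew polynomial `f = x² + f₀`. -/
def f (r : ℕ) : R r := SkewPolynomial.X ^ 2 + SkewPolynomial.C (f₀ r)

/-- The quotient `R / R f` by the left ideal `R f`, a left `R`-module. -/
def RmodRf (r : ℕ) : Type := R r ⧸ Submodule.span (R r) {f r}

instance instAddCommGroupRmodRf (r : ℕ) : AddCommGroup (RmodRf r) :=
  inferInstanceAs (AddCommGroup (R r ⧸ Submodule.span (R r) {f r}))

instance instModuleRmodRf (r : ℕ) : Module (R r) (RmodRf r) :=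
  inferInstanceAs (Module (R r) (R r ⧸ Submodule.span (R r) {f r}))

/-- `K ⊆ L` acts on `R / R f` through left multiplication by constant polynomials. -/
instance instModuleKRmodRf (r : ℕ) : Module (K r) (RmodRf r) :=
  Module.compHom (RmodRf r) ((SkewPolynomial.CRingHom (R := L r)).comp (algebraMap (K r) (L r)))

/-- The class modulo `R f` of a skew polynomial. -/
def cls {r : ℕ} : R r →ₗ[R r] RmodRf r := (Submodule.span (R r) {f r}).mkQ

/-! ### The three multiplications on `R / R f` -/

/-- `m` is the multiplication `⋆_S` with parameter `η`: for all `a₀, a₁, b₀, b₁ ∈ L`,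
`((a₀ - η a₀ f₀) + a₁ x) ⋆_S (b₀ + b₁ x) = ((a₀ - η a₀ f₀) + a₁ x + η a₀ f) (b₀ + b₁ x)`
modulo `R f`. -/
def IsStarS (r : ℕ) (η : L r) (m : RmodRf r →ₗ[K r] RmodRf r →ₗ[K r] RmodRf r) : Prop :=
  ∀ a₀ a₁ b₀ b₁ : L r,
    m (cls (lin (a₀ - η * a₀ * f₀ r) a₁)) (cls (lin b₀ b₁)) =
      cls ((lin (a₀ - η * a₀ * f₀ r) a₁ + SkewPolynomial.C (η * a₀) * f r) * lin b₀ b₁)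

/-- `m` is the multiplication `⋆_D` with parameter `γ`: for all `a₀', a₀'' ∈ L'` and
`a₁, b₀, b₁ ∈ L`,
`((a₀' + γ a₀'') + a₁ x) ⋆_D (b₀ + b₁ x) = ((a₀' + γ a₀'') + a₁ x - (γ / f₀) a₀'' f) (b₀ + b₁ x)`
modulo `R f`. -/
def IsStarD (r : ℕ) (γ : L r) (m : RmodRf r →ₗ[K r] RmodRf r →ₗ[K r] RmodRf r) : Prop :=
  ∀ a₀' ∈ L' r, ∀ a₀'' ∈ L' r, ∀ a₁ b₀ b₁ : L r,
    m (cls (lin (a₀' + γ * a₀'') a₁)) (cls (lin b₀ b₁)) =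
      cls ((lin (a₀' + γ * a₀'') a₁ - SkewPolynomial.C (γ / f₀ r * a₀'') * f r) * lin b₀ b₁)

/-- `m` is the multiplication of the Petit algebra of `f`: the product of the representatives of
degree less than `deg f = 2`, reduced modulo `R f`. -/
def IsPetit (r : ℕ) (m : RmodRf r →ₗ[K r] RmodRf r →ₗ[K r] RmodRf r) : Prop :=
  ∀ a₀ a₁ b₀ b₁ : L r, m (cls (lin a₀ a₁)) (cls (lin b₀ b₁)) = cls (lin a₀ a₁ * lin b₀ b₁)

end

end SkewQuotient

open SkewQuotient

/-! Put `c = f₀`. The quotient is identified with `L × L`, on which `x` acts by `phi`; in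
characteristic two the relation `x ^ 2 = -f₀` reads `x ^ 2 = c`. All three products then belong to
one family `twistMul`: the left factor `(a₀, a₁)` acts as the operator `α(a₀) + a₁ x + β(a₀) x ^ 2`,
where `α + c β` is the identity. For Petit `α = id` and `β = 0`; for `⋆_S` both maps are `L`-linear
with `β = η α`; for `⋆_D` the values of `α` lie in `L'` and those of `β` in `(γ / f₀) L'`.

The arithmetic input is `ne_mul_σ`: `f₀` is never of the form `y σ(y)`. As `r` is odd, `t ^ 2 + t +
1` is prime; `σ` preserves its place, so `y σ(y)` has even valuation there, while `f₀` has a simple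
pole. Hence the form `p = b₀ σ(b₀) - c b₁ σ(b₁)` is anisotropic. If a product vanishes and `a₀ ≠ 0`,
eliminating `a₁` gives `α(a₀) p = -β(a₀) c σ(p)`, which the norm conditions on `η` and `γ` exclude
(`twistMul_noZeroDivisors`).

Right multiplication by an element of the right nucleus commutes with all left multiplications.
Because `σ ^ 2 ≠ 1`, this forces it to be `R`-linear (`eq_and_mem_commutant_of_intertwine`). The
`R`-endomorphisms are the right multiplications by `c₀ + c₁ x` with both coefficients fixed by `σ ^
2`; they form a central algebra of dimension four over `K`, and a division algebra by anisotropy.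
The right nucleus is its opposite, for unital isotopes as well.

Isotopies transport the left and right idealizers of the space of operators. Left multiplication by
`L` preserves the operators of `⋆_S` and of Petit, but a conjugate of it preserving those of `⋆_D`
would consist of scalars in `L' ≠ L` (`not_isotopic_of_left`). Right multiplication by `L` preserves
the operators of Petit, but for `⋆_S` with `η ≠ 0` a conjugate of it would consist of scalars fixed
by `σ ^ 2` (`not_isotopic_of_right`). -/

namespace SkewQuotient

/-! ### Isotopy, division algebras and central nuclei. -/

section Isotopy

universe u v w x

variable {K : Type w} [Field K] {A : Type u} [AddCommGroup A] [Module K A]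
  {B : Type v} [AddCommGroup B] [Module K B] {C : Type x} [AddCommGroup C] [Module K C]
  {m : A →ₗ[K] A →ₗ[K] A} {m' : B →ₗ[K] B →ₗ[K] B} {m'' : C →ₗ[K] C →ₗ[K] C}

theorem KIsotopic.symm (h : KIsotopic m m') : KIsotopic m' m := by
  obtain ⟨h₁, h₂, h₃, h⟩ := h
  refine ⟨h₁.symm, h₂.symm, h₃.symm, fun a b => ?_⟩
  rw [LinearEquiv.symm_apply_eq, h]
  simp

theorem KIsotopic.trans (h : KIsotopic m m') (h' : KIsotopic m' m'') : KIsotopic m m'' := by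
  obtain ⟨h₁, h₂, h₃, h⟩ := h
  obtain ⟨g₁, g₂, g₃, g⟩ := h'
  exact ⟨h₁.trans g₁, h₂.trans g₂, h₃.trans g₃, fun a b => by simp [h, g]⟩

theorem IsDivisionAlgebra.of_isotopic (h : KIsotopic m m') (hm : IsDivisionAlgebra m) :
    IsDivisionAlgebra m' := by
  obtain ⟨h₁, h₂, h₃, h⟩ := h
  obtain ⟨hf, hn, hd⟩ := hm
  refine ⟨h₁.finiteDimensional, h₁.symm.toEquiv.nontrivial, fun a ha => ⟨?_, ?_⟩⟩
  · have : ⇑(m' a) = h₁ ∘ m (h₂.symm a) ∘ h₃.symm := by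
      ext b; simp [h]
    rw [this]
    exact h₁.bijective.comp ((hd _ (by simpa using ha)).1.comp h₃.symm.bijective)
  · have : ⇑(m'.flip a) = h₁ ∘ m.flip (h₃.symm a) ∘ h₂.symm := by
      ext b; simp [h]
    rw [this]
    exact h₁.bijective.comp ((hd _ (by simpa using ha)).2.comp h₂.symm.bijective)

/-- In finite dimension it suffices to exclude zero divisors. -/
theorem isDivisionAlgebra_of_noZeroDivisors [FiniteDimensional K A] [Nontrivial A]
    (h : ∀ a b : A, m a b = 0 → a = 0 ∨ b = 0) : IsDivisionAlgebra m := by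
  refine ⟨inferInstance, inferInstance, fun a ha => ?_⟩
  have h1 : Function.Injective (m a) := by
    rw [injective_iff_map_eq_zero]
    exact fun b hb => (h a b hb).resolve_left ha
  have h2 : Function.Injective (m.flip a) := by
    rw [injective_iff_map_eq_zero]
    exact fun b hb => (h b a hb).resolve_right ha
  exact ⟨⟨h1, LinearMap.surjective_of_injective h1⟩, ⟨h2, LinearMap.surjective_of_injective h2⟩⟩

/-- A central division algebra may be given by a model in any universe. -/
theorem IsCentralDivisionOfDegree.of_equiv {D : Type x} [DivisionRing D] [Algebra K D]
    [Algebra.IsCentral K D] {d : ℕ} (hd : Module.finrank K D = d ^ 2) {N : Submodule K A}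
    (e : D ≃ₗ[K] N) (he : ∀ x y : D, (e (x * y) : A) = m (e x) (e y)) :
    IsCentralDivisionOfDegree m N d := by
  have : Small.{u} D := ⟨N, ⟨e.toEquiv⟩⟩
  let ε : Shrink.{u} D ≃ₐ[K] D := Shrink.algEquiv K D
  refine ⟨Shrink.{u} D, inferInstance, inferInstance, ε.toLinearEquiv.trans e,
    ⟨fun z hz => ?_⟩, ?_, fun x y => ?_⟩
  · have hz' : ε z ∈ Subalgebra.center K D := Subalgebra.mem_center_iff.mpr fun y => by
      simpa using congrArg ε (Subalgebra.mem_center_iff.mp hz (ε.symm y))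
    rw [Algebra.IsCentral.center_eq_bot K D] at hz'
    obtain ⟨k, hk⟩ := Algebra.mem_bot.mp hz'
    exact Algebra.mem_bot.mpr ⟨k, ε.injective (by simpa using hk)⟩
  · rw [← hd]
    exact ε.toLinearEquiv.finrank_eq
  · simp [he]

/-- A commutative central algebra is its own centre, hence of dimension one rather than four. -/
theorem IsCentralDivisionOfDegree.exists_not_commute {N : Submodule K A}
    (h : IsCentralDivisionOfDegree m N 2) : ∃ x ∈ N, ∃ y ∈ N, m x y ≠ m y x := by
  obtain ⟨D, _, _, e, hc, hr, he⟩ := h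
  by_contra! hcon
  have hcomm : ∀ x y : D, x * y = y * x := fun x y => by
    apply e.injective
    apply Subtype.ext
    rw [he, he]
    exact hcon _ (e x).2 _ (e y).2
  have htop : (⊥ : Subalgebra K D) = ⊤ := by
    rw [← Algebra.IsCentral.center_eq_bot K D, eq_top_iff]
    intro x _
    exact Subalgebra.mem_center_iff.mpr fun y => hcomm y x
  have := Subalgebra.bot_eq_top_iff_finrank_eq_one.mp htop
  omega

theorem IsCentralDivisionOfDegree.not_isAssociative
    (h : IsCentralDivisionOfDegree m (rightNucleus m) 2) (hr : Module.finrank K A ≠ 4) :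
    ¬ IsAssociative m := by
  obtain ⟨D, _, _, e, hc, hD, he⟩ := h
  intro ha
  have : rightNucleus m = ⊤ := by
    rw [eq_top_iff]
    exact fun c _ a b => (ha a b c).symm
  have h' := e.finrank_eq
  rw [this, finrank_top, hD] at h'
  exact hr h'.symm

end Isotopy

end SkewQuotient

namespace SkewQuotient

noncomputable section

/-! ### The twisted multiplications on `L × L` and their commutant. -/

section Twisted

variable {K L : Type*} [Field K] [Field L] [Algebra K L] (σ : L ≃ₐ[K] L) (c : L)

/-- Left multiplication by `x` on `L[x; σ] / (x ^ 2 - c)`, in coordinates. -/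
def phi : L × L →ₗ[K] L × L where
  toFun v := (c * σ v.2, σ v.1)
  map_add' u v := by simp [mul_add]
  map_smul' k v := by simp

@[simp] theorem phi_apply (v : L × L) : phi σ c v = (c * σ v.2, σ v.1) := rfl

theorem phi_smul (l : L) (v : L × L) : phi σ c (l • v) = σ l • phi σ c v := by
  ext <;> simp; ring

variable {c} in
theorem phi_surjective (hc0 : c ≠ 0) : Function.Surjective (phi σ c) := fun v =>
  ⟨(σ.symm v.2, σ.symm (c⁻¹ * v.1)), by ext <;> simp [hc0]⟩

variable {c} in
theorem phi_injective (hc0 : c ≠ 0) : Function.Injective (phi σ c) := by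
  rw [injective_iff_map_eq_zero]
  intro v hv
  simp only [phi_apply, Prod.mk_eq_zero, mul_eq_zero, hc0, false_or, map_eq_zero] at hv
  exact Prod.ext hv.2 hv.1

/-- The multiplication `(a₀, a₁) ⋆ v = (α(a₀) + a₁ x + β(a₀) x ^ 2) v` on
`L[x; σ] / (x ^ 2 - c)`. -/
def twistMul (α β : L →ₗ[K] L) : L × L →ₗ[K] L × L →ₗ[K] L × L :=
  LinearMap.mk₂ K
    (fun a v => α a.1 • v + a.2 • phi σ c v + β a.1 • phi σ c (phi σ c v))
    (fun a a' v => by simp only [Prod.fst_add, Prod.snd_add, map_add, add_smul]; abel)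
    (fun k a v => by simp only [Prod.smul_fst, Prod.smul_snd, map_smul, smul_assoc, smul_add])
    (fun a v v' => by simp only [map_add, smul_add]; abel)
    (fun k a v => by simp only [map_smul, smul_add, smul_comm k])

variable {σ c}

theorem twistMul_apply (α β : L →ₗ[K] L) (a v : L × L) :
    twistMul σ c α β a v = α a.1 • v + a.2 • phi σ c v + β a.1 • phi σ c (phi σ c v) := rfl

theorem twistMul_inr (α β : L →ₗ[K] L) (l : L) (v : L × L) :
    twistMul σ c α β (0, l) v = l • phi σ c v := by
  simp [twistMul_apply]

theorem twistMul_one {α β : L →ₗ[K] L} (h : ∀ a, α a + c * β a = a)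
    (a : L × L) : twistMul σ c α β a (1, 0) = a := by
  ext
  · simp [twistMul_apply]
    linear_combination h a.1
  · simp [twistMul_apply]

/-- For `a₀ ≠ 0`, the two coordinates of the product are linear in `a₁`, and eliminating it leaves a
relation between `p` and `σ p`, which have the same norm. For `a₀ = 0` the operator is `a₁ x`, which
is injective. -/
theorem twistMul_noZeroDivisors [FiniteDimensional K L] (hc0 : c ≠ 0) (hc : σ c = c)
    (hN : ∀ b₀ b₁ : L, b₀ * σ b₀ = c * (b₁ * σ b₁) → b₀ = 0 ∧ b₁ = 0) {α β : L →ₗ[K] L}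
    (hαβ : ∀ a, a ≠ 0 → Algebra.norm K (α a) ≠ Algebra.norm K (-(β a * c))) (a v : L × L)
    (h : twistMul σ c α β a v = 0) : a = 0 ∨ v = 0 := by
  by_contra! hcon
  obtain ⟨ha, hv⟩ := hcon
  obtain ⟨a₀, a₁⟩ := a
  obtain ⟨b₀, b₁⟩ := v
  have hp : b₀ * σ b₀ - c * (b₁ * σ b₁) ≠ 0 := fun hp => by
    obtain ⟨h0, h1⟩ := hN _ _ (sub_eq_zero.mp hp)
    exact hv (by simp [h0, h1])
  set p := b₀ * σ b₀ - c * (b₁ * σ b₁) with hpd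
  have h1 := congrArg Prod.fst h
  have h2 := congrArg Prod.snd h
  simp [twistMul_apply] at h1 h2
  by_cases h0 : a₀ = 0
  · have ha1 : a₁ ≠ 0 := fun h1 => ha (by simp [h0, h1])
    simp [h0, ha1, hc0] at h1 h2
    exact hv (by simp [h1, h2])
  · have key : α a₀ * p = -(β a₀ * c) * σ p := by
      rw [hpd]
      simp only [map_sub, map_mul, hc]
      linear_combination σ b₀ * h1 - c * σ b₁ * h2 + β a₀ * c * (σ (σ b₁)) * σ b₁ * hc
    have hn := congrArg (Algebra.norm K) key
    rw [map_mul, map_mul, Algebra.norm_eq_of_algEquiv σ p] at hn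
    exact hαβ a₀ h0 (mul_right_cancel₀ (Algebra.norm_ne_zero_iff.mpr hp) hn)

variable (σ c) in
/-- The `K`-linear maps that commute with `L` and with `x`: the endomorphisms of the
`L[x; σ]`-module `L[x; σ] / (x ^ 2 - c)`. -/
def commutant : Subalgebra K (Module.End K (L × L)) where
  carrier := {T | (∀ (l : L) v, T (l • v) = l • T v) ∧ ∀ v, T (phi σ c v) = phi σ c (T v)}
  mul_mem' := by
    rintro S T ⟨hS, hS'⟩ ⟨hT, hT'⟩
    exact ⟨fun l v => by simp only [Module.End.mul_apply, hT, hS],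
      fun v => by simp only [Module.End.mul_apply, hT', hS']⟩
  add_mem' := by
    rintro S T ⟨hS, hS'⟩ ⟨hT, hT'⟩
    exact ⟨fun l v => by simp only [LinearMap.add_apply, hT, hS, smul_add],
      fun v => by simp only [LinearMap.add_apply, hT', hS', map_add]⟩
  algebraMap_mem' k := ⟨fun l v => by simp [Module.algebraMap_end_apply, smul_comm k],
    fun v => by simp only [Module.algebraMap_end_apply, map_smul]⟩

/-- An intertwining pair of the multiplication `twistMul` is a single element of the commutant. -/
theorem eq_and_mem_commutant_of_intertwine (hc0 : c ≠ 0) (hσ : ∃ l, σ (σ l) ≠ l)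
    {α β : L →ₗ[K] L} (hα : ∃ a, α a = 1) {S T : Module.End K (L × L)}
    (h : ∀ a v, S (twistMul σ c α β a v) = twistMul σ c α β a (T v)) :
    S = T ∧ T ∈ commutant σ c := by
  have hST : ∀ (l : L) v, S (l • phi σ c v) = l • phi σ c (T v) := fun l v => by
    simpa [twistMul_inr] using h (0, l) v
  have hφ : ∀ v, S (phi σ c v) = phi σ c (T v) := fun v => by simpa using hST 1 v
  have hS : ∀ (l : L) v, S (l • v) = l • S v := fun l v => by
    obtain ⟨w, rfl⟩ := phi_surjective σ hc0 v
    rw [hST, hφ]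
  have hT : ∀ (l : L) v, T (l • v) = l • T v := fun l v => phi_injective σ hc0 <| by
    rw [← hφ, phi_smul, phi_smul, hS, hφ]
  obtain ⟨a, ha⟩ := hα
  have key : ∀ v, S v - T v =
      β a • (phi σ c (phi σ c (T v)) - S (phi σ c (phi σ c v))) := fun v => by
    have := h (a, 0) v
    simp only [twistMul_apply, ha, one_smul, zero_smul, add_zero, map_add, hS] at this
    rw [smul_sub, sub_eq_sub_iff_add_eq_add, this]
    abel
  -- Replacing `v` by `l • v` scales the left side of `key` by `l` and the right side by `σ (σ l)`;
  -- since these differ, both sides vanish.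
  obtain ⟨l, hl⟩ := hσ
  have hSTe : ∀ v, S v = T v := fun v => by
    have h1 := key (l • v)
    rw [hS, hT, ← smul_sub, phi_smul, phi_smul, phi_smul, phi_smul, hS, ← smul_sub,
      smul_comm, ← key v, ← sub_eq_zero, ← sub_smul, smul_eq_zero] at h1
    exact sub_eq_zero.mp (h1.resolve_left fun h2 => hl (sub_eq_zero.mp h2).symm)
  have hE : S = T := LinearMap.ext hSTe
  exact ⟨hE, hT, fun v => by rw [← hSTe, hφ]⟩

theorem twistMul_commute_of_mem {T : Module.End K (L × L)} (hT : T ∈ commutant σ c)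
    (α β : L →ₗ[K] L) (a v : L × L) :
    T (twistMul σ c α β a v) = twistMul σ c α β a (T v) := by
  simp only [twistMul_apply, map_add, hT.1, hT.2]

theorem commutant_apply {T : Module.End K (L × L)} (hT : T ∈ commutant σ c) (v : L × L) :
    T v = v.1 • T (1, 0) + v.2 • phi σ c (T (1, 0)) := by
  rw [← hT.2, ← hT.1, ← hT.1, ← map_add]
  congr 1
  ext <;> simp

variable (σ) in
/-- The elements fixed by `σ ^ 2`. -/
def fixSq : Submodule K L := LinearMap.ker ((σ * σ).toLinearMap - LinearMap.id)

theorem mem_fixSq {l : L} : l ∈ fixSq σ ↔ σ (σ l) = l := by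
  simp [fixSq, sub_eq_zero]

/-- `x ^ 2` multiplies `(1, 0)` by `c`, hence also its image under `T`; on each coordinate `x ^ 2`
acts as `c σ ^ 2`. -/
theorem commutant_apply_one_mem (hc0 : c ≠ 0) (hc : σ c = c) {T : Module.End K (L × L)}
    (hT : T ∈ commutant σ c) : (T (1, 0)).1 ∈ fixSq σ ∧ (T (1, 0)).2 ∈ fixSq σ := by
  have h : phi σ c (phi σ c (T (1, 0))) = c • T (1, 0) := by
    rw [← hT.2, ← hT.2, ← hT.1]
    congr 1
    ext <;> simp
  rw [Prod.ext_iff] at h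
  simpa [hc, hc0, mem_fixSq] using h

/-- Elements of the commutant are the right multiplications by `c₀ + c₁ x` with `c₀` and `c₁`
fixed by `σ ^ 2`. -/
def commutantEquiv (hc0 : c ≠ 0) (hc : σ c = c) : commutant σ c ≃ₗ[K] fixSq σ × fixSq σ where
  toFun T := (⟨((T : Module.End K (L × L)) (1, 0)).1, (commutant_apply_one_mem hc0 hc T.2).1⟩,
    ⟨((T : Module.End K (L × L)) (1, 0)).2, (commutant_apply_one_mem hc0 hc T.2).2⟩)
  map_add' _ _ := rfl
  map_smul' _ _ := rfl
  invFun d := ⟨{  toFun v := v.1 • ((d.1 : L), (d.2 : L)) + v.2 • phi σ c ((d.1 : L), (d.2 : L))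
                  map_add' u v := by simp only [Prod.fst_add, Prod.snd_add, add_smul]; abel
                  map_smul' k v := by
                    simp only [Prod.smul_fst, Prod.smul_snd, smul_assoc, smul_add]; rfl },
    fun l v => by
      simp only [LinearMap.coe_mk, AddHom.coe_mk, Prod.smul_fst, Prod.smul_snd, smul_assoc,
        smul_add],
    fun v => by
      have h1 := mem_fixSq.mp d.1.2
      have h2 := mem_fixSq.mp d.2.2
      ext
      · simp [hc, h1, h2]; ring
      · simp [hc, h1, h2]; ring⟩
  left_inv T := Subtype.ext (LinearMap.ext fun v => (commutant_apply T.2 v).symm)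
  right_inv d := by ext <;> simp

theorem commutantEquiv_apply (hc0 : c ≠ 0) (hc : σ c = c) (T : commutant σ c) :
    (((commutantEquiv hc0 hc T).1 : L), ((commutantEquiv hc0 hc T).2 : L)) =
      (T : Module.End K (L × L)) (1, 0) := rfl

theorem commutantEquiv_symm_apply_one (hc0 : c ≠ 0) (hc : σ c = c) (d : fixSq σ × fixSq σ) :
    ((commutantEquiv hc0 hc).symm d : Module.End K (L × L)) (1, 0) = ((d.1 : L), (d.2 : L)) := by
  rw [← commutantEquiv_apply hc0 hc, LinearEquiv.apply_symm_apply]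

theorem finrank_commutant [FiniteDimensional K L] (hc0 : c ≠ 0) (hc : σ c = c)
    (hF : Module.finrank K (fixSq σ) = 2) : Module.finrank K (commutant σ c) = 2 ^ 2 := by
  rw [(commutantEquiv hc0 hc).finrank_eq, Module.finrank_prod, hF]; norm_num

/-- The module is simple: any nonzero `v = (b₀, b₁)` generates it, since `σ b₀ • v - b₁ • x v` is a
nonzero multiple of the generator `(1, 0)`, by anisotropy. -/
theorem commutant_injective
    (hN : ∀ b₀ b₁ : L, b₀ * σ b₀ = c * (b₁ * σ b₁) → b₀ = 0 ∧ b₁ = 0)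
    {T : Module.End K (L × L)} (hT : T ∈ commutant σ c) {v : L × L} (h : T v = 0) (hv : v ≠ 0) :
    T = 0 := by
  obtain ⟨b₀, b₁⟩ := v
  have hp : b₀ * σ b₀ - c * (b₁ * σ b₁) ≠ 0 := fun hp => by
    obtain ⟨h0, h1⟩ := hN _ _ (sub_eq_zero.mp hp)
    exact hv (by simp [h0, h1])
  have h1 : T ((b₀ * σ b₀ - c * (b₁ * σ b₁)) • (1, 0)) = 0 := by
    have : (b₀ * σ b₀ - c * (b₁ * σ b₁)) • ((1, 0) : L × L) =
        σ b₀ • (b₀, b₁) - b₁ • phi σ c (b₀, b₁) := by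
      ext
      · simp; ring
      · simp; ring
    rw [this, map_sub, hT.1, hT.1, hT.2, h]
    simp
  rw [hT.1, smul_eq_zero] at h1
  ext1 <;> ext1 <;> · rw [LinearMap.comp_apply, commutant_apply hT, h1.resolve_left hp]; simp

theorem commutant_isDomain
    (hN : ∀ b₀ b₁ : L, b₀ * σ b₀ = c * (b₁ * σ b₁) → b₀ = 0 ∧ b₁ = 0) :
    IsDomain (commutant σ c) := by
  have : NoZeroDivisors (commutant σ c) := ⟨fun {S T} h => by
    by_contra! hcon
    obtain ⟨v, hv⟩ : ∃ v, (T : Module.End K (L × L)) v ≠ 0 := by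
      by_contra! h0
      exact hcon.2 (Subtype.ext (LinearMap.ext h0))
    refine hcon.1 (Subtype.ext (commutant_injective hN S.2 ?_ hv))
    exact congrArg (fun U : commutant σ c => (U : Module.End K (L × L)) v) h⟩
  exact NoZeroDivisors.to_isDomain (commutant σ c)

/-- Commuting with right multiplication by `x` makes `c₀` fixed by `σ`, and commuting with that by
an `l` moved by `σ` kills `c₁`. -/
theorem commutant_isCentral (hc0 : c ≠ 0) (hc : σ c = c)
    (hfix : ∀ l, σ l = l → ∃ k, algebraMap K L k = l) (hF : ∃ l ∈ fixSq σ, σ l ≠ l) :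
    Algebra.IsCentral K (commutant σ c) := by
  refine ⟨fun T hT => ?_⟩
  obtain ⟨l, hl, hl'⟩ := hF
  set c₀ := ((T : Module.End K (L × L)) (1, 0)).1 with hc₀
  set c₁ := ((T : Module.End K (L × L)) (1, 0)).2 with hc₁
  have hT1 : (T : Module.End K (L × L)) (1, 0) = (c₀, c₁) := rfl
  have comm : ∀ d : fixSq σ × fixSq σ,
      (d.1 : L) • (c₀, c₁) + (d.2 : L) • phi σ c (c₀, c₁) =
        c₀ • ((d.1 : L), (d.2 : L)) + c₁ • phi σ c ((d.1 : L), (d.2 : L)) := fun d => by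
    have h := congrArg (fun U : commutant σ c => (U : Module.End K (L × L)) (1, 0))
      (Subalgebra.mem_center_iff.mp hT ((commutantEquiv hc0 hc).symm d))
    simp only [MulMemClass.coe_mul, Module.End.mul_apply, commutantEquiv_symm_apply_one] at h
    rw [hT1, commutant_apply (((commutantEquiv hc0 hc).symm d).2), commutant_apply T.2,
      commutantEquiv_symm_apply_one, hT1] at h
    exact h.symm
  have h1 := comm (0, ⟨1, by simp [mem_fixSq]⟩)
  have h2 := comm (⟨l, hl⟩, 0)
  have e0 : σ c₀ = c₀ := by simpa using congrArg Prod.snd h1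
  have e1 : c₁ = 0 := by
    have := congrArg Prod.snd h2
    simp only [Prod.smul_mk, ZeroMemClass.coe_zero, zero_smul, add_zero, phi_apply, map_zero,
      mul_zero, smul_eq_mul, Prod.snd_add, zero_add] at this
    by_contra h0
    exact hl' (mul_left_cancel₀ h0 (by rw [← this, mul_comm]))
  obtain ⟨k, hk⟩ := hfix _ e0
  refine Algebra.mem_bot.mpr ⟨k, Subtype.ext (LinearMap.ext fun v => ?_)⟩
  rw [commutant_apply T.2, hT1, e1, ← hk]
  ext <;> simp [Algebra.smul_def, mul_comm]

end Twisted

/-! ### Right nuclei of isotopes and obstructions to isotopy. -/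

section TwistedIsotopy

variable {K L : Type*} [Field K] [Field L] [Algebra K L] {σ : L ≃ₐ[K] L} {c : L}

/-- The right nucleus of a division algebra with a right identity that is isotopic to `twistMul`
is opposite to the commutant. -/
theorem rightNucleus_isCentralDivision [FiniteDimensional K L] (hc0 : c ≠ 0) (hc : σ c = c)
    (hN : ∀ b₀ b₁ : L, b₀ * σ b₀ = c * (b₁ * σ b₁) → b₀ = 0 ∧ b₁ = 0)
    (hfix : ∀ l, σ l = l → ∃ k, algebraMap K L k = l) (hσ : ∃ l, σ (σ l) ≠ l)
    (hF : ∃ l ∈ fixSq σ, σ l ≠ l) (hF2 : Module.finrank K (fixSq σ) = 2)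
    {α β : L →ₗ[K] L} (hα : ∃ a, α a = 1)
    {B : Type*} [AddCommGroup B] [Module K B] {m : B →ₗ[K] B →ₗ[K] B} (hm : IsDivisionAlgebra m)
    {e : B} (he : ∀ b, m b e = b) (h₁ h₂ h₃ : (L × L) ≃ₗ[K] B)
    (h : ∀ a v, h₁ (twistMul σ c α β a v) = m (h₂ a) (h₃ v))
    (hcomp : ∀ T ∈ commutant σ c, ∀ b, h₁ (T (h₁.symm b)) = h₃ (T (h₃.symm b))) :
    IsCentralDivisionOfDegree m (rightNucleus m) 2 := by
  have hU : ∀ T ∈ commutant σ c, ∀ b b', h₃ (T (h₃.symm (m b b'))) = m b (h₃ (T (h₃.symm b'))) :=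
    fun T hT b b' => by
      have h' : m b b' = h₁ (twistMul σ c α β (h₂.symm b) (h₃.symm b')) := by simp [h]
      rw [← hcomp T hT, h', LinearEquiv.symm_apply_apply, twistMul_commute_of_mem hT, h]
      simp
  have hUe : ∀ T ∈ commutant σ c, ∀ b, h₃ (T (h₃.symm b)) = m b (h₃ (T (h₃.symm e))) :=
    fun T hT b => by rw [← hU T hT, he]
  -- The `h₃`-conjugate of `T` commutes with all left multiplications, so it is right multiplication
  -- by its value at the right identity `e`.
  let g : commutant σ c →ₗ[K] rightNucleus m :=
    { toFun T := ⟨h₃ ((T : Module.End K (L × L)) (h₃.symm e)), fun a b => by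
        rw [← hUe _ T.2, ← hUe _ T.2, hU _ T.2]⟩
      map_add' S T := Subtype.ext (by simp)
      map_smul' k T := Subtype.ext (by simp) }
  have hg : Function.Bijective g := by
    constructor
    · rw [injective_iff_map_eq_zero]
      intro T hT
      refine Subtype.ext (LinearMap.ext fun v => h₃.injective ?_)
      have h0 : h₃ ((T : Module.End K (L × L)) (h₃.symm e)) = 0 := congrArg Subtype.val hT
      have := hUe _ T.2 (h₃ v)
      rw [h0, LinearEquiv.symm_apply_apply] at this
      simpa using this
    · rintro ⟨d, hd⟩
      obtain ⟨hST, hT⟩ := eq_and_mem_commutant_of_intertwine (σ := σ) (β := β) hc0 hσ hα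
        (S := h₁.symm.toLinearMap ∘ₗ m.flip d ∘ₗ h₁.toLinearMap)
        (T := h₃.symm.toLinearMap ∘ₗ m.flip d ∘ₗ h₃.toLinearMap) (fun a v => by
          simp only [LinearMap.comp_apply, LinearEquiv.coe_coe, LinearMap.flip_apply]
          rw [LinearEquiv.symm_apply_eq, h, h, LinearEquiv.apply_symm_apply]
          exact (hd _ _).symm)
      refine ⟨⟨_, hT⟩, Subtype.ext ?_⟩
      -- As `e` is only a right identity, `m e d = d` is obtained from the nucleus identity `m b (m
      -- e d) = m b d` by cancelling `b ≠ 0`.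
      have hn := hm.2.1
      obtain ⟨b, hb⟩ := exists_ne (0 : B)
      apply (hm.2.2 b hb).1.1
      have := hd b e
      rw [he] at this
      simpa [g] using this
  have := commutant_isDomain hN
  have := commutant_isCentral hc0 hc hfix hF
  have : FiniteDimensional K (commutant σ c) := inferInstance
  let i : DivisionRing (commutant σ c) := divisionRingOfFiniteDimensional K (commutant σ c)
  -- Right multiplications compose in reverse order, whence the opposite algebra.
  let e' : (commutant σ c)ᵐᵒᵖ ≃ₗ[K] rightNucleus m :=
    (MulOpposite.opLinearEquiv K).symm.trans (LinearEquiv.ofBijective g hg)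
  refine IsCentralDivisionOfDegree.of_equiv (D := (commutant σ c)ᵐᵒᵖ) ?_ e' fun x y => ?_
  · rw [← (MulOpposite.opLinearEquiv K).finrank_eq]
    exact finrank_commutant hc0 hc hF2
  · have := hUe _ y.unop.2 (h₃ (((x.unop : commutant σ c) : Module.End K (L × L)) (h₃.symm e)))
    rw [LinearEquiv.symm_apply_apply] at this
    exact this

theorem coeff_eq_of_two (hσ : ∃ l, σ (σ l) ≠ l) {A B : L} (h : ∀ b, A * b + B * σ (σ b) = 0) :
    A = 0 ∧ B = 0 := by
  obtain ⟨l, hl⟩ := hσ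
  have h1 := h 1
  simp only [map_one, mul_one] at h1
  have hB : B * (σ (σ l) - l) = 0 := by linear_combination h l - l * h1
  have hB' : B = 0 := (mul_eq_zero.mp hB).resolve_right (sub_ne_zero.mpr hl)
  exact ⟨by simpa [hB'] using h1, hB'⟩

/-- Artin's argument for independence of automorphisms: comparing the relation at `l b` with `l`
times the relation at `b` removes the first term and leaves a relation between `1` and `σ ^ 2`. -/
theorem coeff_eq_of_three (hσ : ∃ l, σ (σ l) ≠ l) (hσ' : ∃ l, σ (σ (σ (σ l))) ≠ l) {A B C : L}
    (h : ∀ b, A * b + B * σ (σ b) + C * σ (σ (σ (σ b))) = 0) : C = 0 := by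
  obtain ⟨l, hl⟩ := hσ'
  have h2 : C * (σ (σ (σ (σ l))) - l) = 0 := by
    refine (coeff_eq_of_two hσ (A := B * (σ (σ l) - l)) fun b => ?_).2
    have h1 := h (l * σ.symm (σ.symm b))
    have h0 := h (σ.symm (σ.symm b))
    simp only [map_mul, AlgEquiv.apply_symm_apply] at h1 h0
    linear_combination h1 - l * h0
  exact (mul_eq_zero.mp h2).resolve_right (sub_ne_zero.mpr hl)

/-- On `(b, 0)` the even powers of `x` contribute only to the first coordinate and `x` only to the
second; `1` and `σ ^ 2` are independent. -/
theorem twistMul_coeff_eq (hc0 : c ≠ 0) (hσ : ∃ l, σ (σ l) ≠ l)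
    {x₀ x₁ x₂ y₀ y₁ y₂ : L}
    (h : ∀ v, x₀ • v + x₁ • phi σ c v + x₂ • phi σ c (phi σ c v) =
      y₀ • v + y₁ • phi σ c v + y₂ • phi σ c (phi σ c v)) : x₀ = y₀ ∧ x₁ = y₁ ∧ x₂ = y₂ := by
  have h2 := coeff_eq_of_two hσ (A := x₀ - y₀) (B := c * (x₂ - y₂)) fun b => by
    have := congrArg Prod.fst (h (b, 0))
    simp at this
    linear_combination this
  have h1 := congrArg Prod.snd (h (1, 0))
  simp at h1
  simp only [mul_eq_zero, hc0, false_or, sub_eq_zero] at h2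
  exact ⟨h2.1, h1, h2.2⟩

/-- If a conjugate of the multiplication by each element of `L` is the multiplication by an element
of `W`, then `W = L`. -/
theorem eq_top_of_conj [FiniteDimensional K L] (W : Submodule K L) (h : (L × L) ≃ₗ[K] L × L)
    (hW : ∀ l : L, ∃ x ∈ W, ∀ v, h (l • h.symm v) = x • v) : W = ⊤ := by
  let g : L →ₗ[K] L :=
    { toFun l := (h (l • h.symm (1, 0))).1
      map_add' l l' := by simp only [add_smul, map_add, Prod.fst_add]
      map_smul' k l := by simp only [smul_assoc, map_smul, Prod.smul_fst, RingHom.id_apply] }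
  have hinj : Function.Injective g := by
    rw [injective_iff_map_eq_zero]
    intro l hl
    obtain ⟨x, -, hx⟩ := hW l
    have h1 : (h (l • h.symm (1, 0))).1 = 0 := hl
    have h2 : h (l • h.symm (1, 0)) = 0 := by
      rw [hx] at h1 ⊢
      simpa using h1
    rw [LinearEquiv.map_eq_zero_iff, smul_eq_zero, LinearEquiv.map_eq_zero_iff] at h2
    exact h2.resolve_right (by simp)
  rw [eq_top_iff]
  intro y _
  obtain ⟨l, rfl⟩ := LinearMap.surjective_of_injective hinj y
  obtain ⟨x, hxW, hx⟩ := hW l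
  have : g l = x := by simp [g, hx]
  rwa [this]

/-- The left idealizer of the second multiplication is too small. -/
theorem not_isotopic_of_left [FiniteDimensional K L] (hc0 : c ≠ 0)
    (hσ : ∃ l, σ (σ l) ≠ l) {α β α' β' : L →ₗ[K] L}
    (hα : ∀ l a, α (l * a) = l * α a) (hβ : ∀ l a, β (l * a) = l * β a)
    (F : IntermediateField K L) (hF : F ≠ ⊤) (δ : L) (hα' : ∀ a, α' a ∈ F)
    (hβ' : ∀ a, ∃ w ∈ F, β' a = δ * w) (h1 : ∃ a, α' a = 1 ∧ β' a = 0) :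
    ¬ KIsotopic (twistMul σ c α β) (twistMul σ c α' β') := by
  rintro ⟨h₁, h₂, h₃, h⟩
  obtain ⟨y, hy⟩ : ∃ y, y ∉ F := by
    by_contra! hcon
    exact hF (eq_top_iff.mpr fun y _ => hcon y)
  -- By `L`-linearity of `α` and `β`, the first operators are stable under left multiplication by
  -- `l`; the isotopy moves this to the map `X = h₁ l h₁⁻¹`, which acts on the second operators from
  -- the left.
  have hX : ∀ (l : L) b, ∃ b', ∀ w, h₁ (l • h₁.symm (twistMul σ c α' β' b w)) =
      twistMul σ c α' β' b' w := fun l b => by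
    refine ⟨h₂ (l • h₂.symm b), fun w => ?_⟩
    have e1 : twistMul σ c α' β' b w = h₁ (twistMul σ c α β (h₂.symm b) (h₃.symm w)) := by simp [h]
    have e2 : ∀ v, l • twistMul σ c α β (h₂.symm b) v = twistMul σ c α β (l • h₂.symm b) v :=
      fun v => by
        simp only [twistMul_apply, Prod.smul_fst, Prod.smul_snd, smul_eq_mul, hα, hβ, smul_add,
          smul_smul]
    rw [e1, LinearEquiv.symm_apply_apply, e2, h, LinearEquiv.apply_symm_apply]
  refine hF (IntermediateField.toSubalgebra_injective (Subalgebra.toSubmodule_injective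
    (eq_top_of_conj (Subalgebra.toSubmodule F.toSubalgebra) h₁ fun l => ?_)))
  obtain ⟨⟨a, a₁⟩, ha⟩ := hX l (0, 1)
  -- Apply `X` to `z x = x σ⁻¹(z)` and compare coefficients: all multiples of `α' a` would be values
  -- of `α'`, which lie in `F ≠ L`, and similarly for `β'`. So both vanish, `X x = a₁ x`, and `X` is
  -- the scalar `a₁`.
  have ha2 : ∀ z, ∃ a', α' a * σ.symm z = α' a' ∧ β' a * σ z = β' a' := fun z => by
    obtain ⟨⟨a', a₁'⟩, ha'⟩ := hX l (0, z)
    refine ⟨a', ?_⟩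
    have := twistMul_coeff_eq hc0 hσ (x₀ := α' a * σ.symm z) (x₁ := a₁ * z) (x₂ := β' a * σ z)
      (y₀ := α' a') (y₁ := a₁') (y₂ := β' a') fun v => by
        have e1 := ha (σ.symm z • v)
        rw [twistMul_inr, phi_smul, one_smul, AlgEquiv.apply_symm_apply] at e1
        have e2 := ha' v
        rw [twistMul_inr, e1] at e2
        simp only [twistMul_apply, phi_smul, AlgEquiv.apply_symm_apply, smul_smul] at e2
        exact e2
    exact ⟨this.1, this.2.2⟩
  have hu : α' a = 0 := by
    by_contra h0
    obtain ⟨a', ha', -⟩ := ha2 (σ ((α' a)⁻¹ * y))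
    rw [AlgEquiv.symm_apply_apply, mul_inv_cancel_left₀ h0] at ha'
    exact hy (ha' ▸ hα' a')
  have hz : β' a = 0 := by
    by_contra h0
    obtain ⟨w, hw, hwa⟩ := hβ' a
    obtain ⟨a', -, ha'⟩ := ha2 (σ.symm y)
    obtain ⟨w', hw', hwa'⟩ := hβ' a'
    rw [hwa] at h0
    obtain ⟨hδ, hw0⟩ := mul_ne_zero_iff.mp h0
    rw [AlgEquiv.apply_symm_apply, hwa, hwa', mul_assoc] at ha'
    have := mul_left_cancel₀ hδ ha'
    rw [mul_comm, ← eq_div_iff hw0] at this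
    exact hy (this ▸ div_mem hw' hw)
  have hXa : ∀ v, h₁ (l • h₁.symm v) = a₁ • v := fun v => by
    obtain ⟨w, rfl⟩ := phi_surjective σ hc0 v
    have := ha w
    rw [twistMul_inr, one_smul] at this
    rw [this]
    simp [twistMul_apply, hu, hz]
  refine ⟨a₁, ?_, hXa⟩
  -- The identity is one of the second operators, so `X` itself is one, and its constant coefficient
  -- `a₁` is a value of `α'`.
  obtain ⟨a, ha1, ha0⟩ := h1
  obtain ⟨⟨a', a₁'⟩, ha'⟩ := hX l (a, 0)
  have := twistMul_coeff_eq hc0 hσ (x₀ := a₁) (x₁ := 0) (x₂ := 0)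
      (y₀ := α' a') (y₁ := a₁') (y₂ := β' a') fun v => by
    have e := ha' v
    rw [hXa] at e
    simpa [twistMul_apply, ha1, ha0] using e
  rw [this.1]
  exact hα' a'

/-- The right idealizer of the second multiplication is too small. -/
theorem not_isotopic_of_right [FiniteDimensional K L] (hc0 : c ≠ 0) (hc : σ c = c)
    (hσ : ∃ l, σ (σ l) ≠ l) (hσ' : ∃ l, σ (σ (σ (σ l))) ≠ l) {η : L} (hη : η ≠ 0)
    {α β α' β' : L →ₗ[K] L}
    (hl : ∀ (l : L) a, ∃ a', ∀ v, twistMul σ c α β a (l • v) = twistMul σ c α β a' v)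
    (h1 : ∃ a, α' a = 1) (hβ' : ∀ a, β' a = η * α' a) :
    ¬ KIsotopic (twistMul σ c α β) (twistMul σ c α' β') := by
  rintro ⟨h₁, h₂, h₃, h⟩
  obtain ⟨l₀, hl₀⟩ := id hσ
  have hX : ∀ (l : L) b, ∃ b', ∀ w, twistMul σ c α' β' b (h₃ (l • h₃.symm w)) =
      twistMul σ c α' β' b' w := fun l b => by
    obtain ⟨a', ha'⟩ := hl l (h₂.symm b)
    refine ⟨h₂ a', fun w => ?_⟩
    have e := h (h₂.symm b) (l • h₃.symm w)
    rw [LinearEquiv.apply_symm_apply] at e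
    rw [← e, ha', h, LinearEquiv.apply_symm_apply]
  have htop := eq_top_of_conj (fixSq σ) h₃ fun l => by
    obtain ⟨⟨a, a₁⟩, ha⟩ := hX l (0, 1)
    obtain ⟨e, he⟩ := h1
    obtain ⟨⟨a', a₁'⟩, ha'⟩ := hX l (e, 0)
    simp only [twistMul_apply, hβ', he, map_zero, zero_smul, zero_add, add_zero, one_smul,
      mul_zero, mul_one] at ha ha'
    set u := α' a
    set u' := α' a'
    -- Write `X = h₃ l h₃⁻¹`. Then `x X` and `(1 + η x ^ 2) X` are both operators of the second
    -- algebra, and `x (1 + η x ^ 2) X` is computed from each of them.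
    have key : ∀ v, u • v + a₁ • phi σ c v + (η * u) • phi σ c (phi σ c v) +
        σ η • phi σ c (phi σ c (u • v + a₁ • phi σ c v + (η * u) • phi σ c (phi σ c v))) =
        σ u' • phi σ c v + σ a₁' • phi σ c (phi σ c v) +
          (σ η * σ u') • phi σ c (phi σ c (phi σ c v)) := fun v => by
      rw [← ha v]
      have := congrArg (phi σ c) (ha' v)
      simpa only [map_add, phi_smul, map_mul] using this
    -- This is the coefficient of `σ ^ 4`; it is independent of the lower even powers, and it forces
    -- `u = 0`.
    have hu : σ η * σ (σ (η * u)) * c * c = 0 :=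
      coeff_eq_of_three hσ hσ' (A := u) (B := (η * u + σ η * σ (σ u) - σ a₁') * c) fun b => by
        have := congrArg Prod.fst (key (b, 0))
        simp [hc] at this
        simp only [map_mul]
        linear_combination this
    have hu0 : u = 0 := by simpa [hη, hc0] using hu
    -- The odd part compares the coefficients of `x` and `x ^ 3`: both `a₁` and `σ (σ a₁)` equal `σ
    -- u'`, so `X` is the scalar `u'`, fixed by `σ ^ 2`.
    have hodd := coeff_eq_of_two hσ (A := a₁ - σ u')
      (B := (σ η * σ (σ a₁) - σ η * σ u') * c) fun b => by
        have := congrArg Prod.snd (key (σ.symm b, 0))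
        simp [hc, hu0] at this
        linear_combination this
    have e1 : a₁ = σ u' := sub_eq_zero.mp hodd.1
    have e2 : σ (σ a₁) = σ u' := by
      have := (mul_eq_zero.mp hodd.2).resolve_right hc0
      rw [← mul_sub, mul_eq_zero] at this
      exact sub_eq_zero.mp (this.resolve_left (by simpa using hη))
    refine ⟨u', mem_fixSq.mpr (σ.injective ?_), fun v => ?_⟩
    · rw [← e1, e2, e1]
    · apply phi_injective σ hc0
      rw [ha v, hu0, phi_smul, e1]
      simp
  exact hl₀ (mem_fixSq.mp (htop ▸ Submodule.mem_top))

end TwistedIsotopy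

/-! ### The values of `σ` and its action on `K`. -/

open Polynomial in
theorem θ_algebraMap (r : ℕ) (p : (Fq r)[X]) :
    θ r (algebraMap (Fq r)[X] (L r) p) = aeval (t r)⁻¹ p := by
  have := RatFunc.liftAlgHom_apply_div (aeval (t r)⁻¹)
    (nonZeroDivisors_le_comap_nonZeroDivisors_of_injective _
      (transcendental_iff_injective.mp (transcendental_t_inv r))) p 1
  simpa using! this

open Polynomial in
theorem τ_algebraMap (r : ℕ) (p : (Fq r)[X]) :
    τ r (algebraMap (Fq r)[X] (L r) p) =
      algebraMap (Fq r)[X] (L r) (p.map (frobenius (Fq r) 2)) := by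
  have := RatFunc.map_apply_div (Polynomial.mapRingHom (frobenius (Fq r) 2))
    (nonZeroDivisors_le_comap_nonZeroDivisors_of_injective _
      (Polynomial.map_injective _ (frobenius (Fq r) 2).injective)) p 1
  simpa using! this

open Polynomial in
theorem σ_algebraMap (r : ℕ) (p : (Fq r)[X]) :
    σ r (algebraMap (Fq r)[X] (L r) p) = aeval (t r)⁻¹ (p.map (frobenius (Fq r) 2)) := by
  rw [σ, RingHom.comp_apply, τ_algebraMap]
  exact θ_algebraMap r _

theorem θ_t (r : ℕ) : θ r (t r) = (t r)⁻¹ := by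
  simpa [RatFunc.algebraMap_X] using! θ_algebraMap r Polynomial.X

@[simp] theorem σ_t (r : ℕ) : σ r (t r) = (t r)⁻¹ := by
  simpa [RatFunc.algebraMap_X] using! σ_algebraMap r Polynomial.X

theorem σ_C (r : ℕ) (a : Fq r) : σ r (RatFunc.C a) = RatFunc.C (a ^ 2) := by
  simpa [RatFunc.algebraMap_C, frobenius_def] using! σ_algebraMap r (Polynomial.C a)

theorem s_eq (r : ℕ) : s r = t r + (t r)⁻¹ := by rw [s, θ_t]

theorem t_ne_zero (r : ℕ) : t r ≠ 0 := RatFunc.X_ne_zero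

@[simp] theorem σ_s (r : ℕ) : σ r (s r) = s r := by
  rw [s_eq, map_add, map_inv₀, σ_t, inv_inv, add_comm]

theorem s_mem_K (r : ℕ) : s r ∈ K r := IntermediateField.mem_adjoin_simple_self _ _

theorem σ_of_mem_K (r : ℕ) {x : L r} (hx : x ∈ K r) : σ r x = x := by
  induction hx using IntermediateField.adjoin_induction with
  | mem x hx => rw [Set.mem_singleton_iff.mp hx, σ_s]
  | algebraMap z =>
    exact DFunLike.congr_fun
      (Subsingleton.elim ((σ r).comp (algebraMap (ZMod 2) (L r))) (algebraMap (ZMod 2) (L r))) z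
  | add x y _ _ hx hy => rw [map_add, hx, hy]
  | inv x _ hx => rw [map_inv₀, hx]
  | mul x y _ _ hx hy => rw [map_mul, hx, hy]

theorem K_le_L' (r : ℕ) {x : L r} (hx : x ∈ K r) : x ∈ L' r := by
  induction hx using IntermediateField.adjoin_induction with
  | mem x hx =>
    rw [Set.mem_singleton_iff.mp hx]
    exact IntermediateField.mem_adjoin_simple_self _ _
  | algebraMap z =>
    rw [IsScalarTower.algebraMap_apply (ZMod 2) (Fq r) (L r)]
    exact (L' r).algebraMap_mem _
  | add x y _ _ hx hy => exact add_mem hx hy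
  | inv x _ hx => exact inv_mem hx
  | mul x y _ _ hx hy => exact mul_mem hx hy

/-! ### `L` is spanned over `K` by the elements `a` and `a t` with `a` constant -/

theorem t_mul_t (r : ℕ) : t r * t r = s r * t r + 1 := by
  have h2 : (2 : L r) = 0 := CharTwo.two_eq_zero
  have := t_ne_zero r
  rw [s_eq]
  field_simp
  linear_combination -h2

/-- The constants and their multiples by `t`. -/
def spanningSet (r : ℕ) : Set (L r) :=
  Set.range (fun a : Fq r => RatFunc.C a) ∪ Set.range (fun a : Fq r => RatFunc.C a * t r)

theorem C_mul_mem_span (r : ℕ) (a : Fq r) {x : L r}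
    (hx : x ∈ Submodule.span (K r) (spanningSet r)) :
    RatFunc.C a * x ∈ Submodule.span (K r) (spanningSet r) := by
  induction hx using Submodule.span_induction with
  | mem x hx =>
    apply Submodule.subset_span
    rcases hx with ⟨b, rfl⟩ | ⟨b, rfl⟩
    · exact Or.inl ⟨a * b, by simp⟩
    · exact Or.inr ⟨a * b, by simp [mul_assoc]⟩
  | zero => simp
  | add x y _ _ hx hy => rw [mul_add]; exact add_mem hx hy
  | smul k x _ hx => rw [mul_smul_comm]; exact Submodule.smul_mem _ _ hx

theorem t_mul_mem_span (r : ℕ) {x : L r}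
    (hx : x ∈ Submodule.span (K r) (spanningSet r)) :
    t r * x ∈ Submodule.span (K r) (spanningSet r) := by
  induction hx using Submodule.span_induction with
  | mem x hx =>
    rcases hx with ⟨b, rfl⟩ | ⟨b, rfl⟩
    · exact Submodule.subset_span (Or.inr ⟨b, mul_comm _ _⟩)
    · have : t r * (RatFunc.C b * t r) =
          (⟨s r, s_mem_K r⟩ : K r) • (RatFunc.C b * t r) + RatFunc.C b := by
        rw [IntermediateField.smul_def, smul_eq_mul]
        linear_combination RatFunc.C b * t_mul_t r
      simp only [this]
      exact add_mem (Submodule.smul_mem _ _ (Submodule.subset_span (Or.inr ⟨b, rfl⟩)))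
        (Submodule.subset_span (Or.inl ⟨b, rfl⟩))
  | zero => simp
  | add x y _ _ hx hy => rw [mul_add]; exact add_mem hx hy
  | smul k x _ hx => rw [mul_smul_comm]; exact Submodule.smul_mem _ _ hx

theorem algebraMap_mul_mem_span (r : ℕ) (p : Polynomial (Fq r)) {x : L r}
    (hx : x ∈ Submodule.span (K r) (spanningSet r)) :
    algebraMap (Polynomial (Fq r)) (L r) p * x ∈ Submodule.span (K r) (spanningSet r) := by
  induction p using Polynomial.induction_on' with
  | add p q hp hq => rw [map_add, add_mul]; exact add_mem hp hq
  | monomial n a =>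
    have hn : t r ^ n * x ∈ Submodule.span (K r) (spanningSet r) := by
      induction n with
      | zero => simpa using hx
      | succ n ih => rw [pow_succ', mul_assoc]; exact t_mul_mem_span r ih
    rw [← Polynomial.C_mul_X_pow_eq_monomial, map_mul, map_pow, RatFunc.algebraMap_C,
      RatFunc.algebraMap_X, mul_assoc]
    exact C_mul_mem_span r a hn

/-- The span is finite-dimensional over `K` and stable under multiplication by polynomials.
Multiplication by a nonzero `q` is injective on it, hence surjective, so it contains all quotients
`p / q`. -/
theorem span_spanningSet (r : ℕ) : Submodule.span (K r) (spanningSet r) = ⊤ := by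
  have hfin : FiniteDimensional (K r) (Submodule.span (K r) (spanningSet r)) :=
    FiniteDimensional.span_of_finite _ ((Set.finite_range _).union (Set.finite_range _))
  have h1 : (1 : L r) ∈ Submodule.span (K r) (spanningSet r) :=
    Submodule.subset_span (Or.inl ⟨1, by simp⟩)
  rw [eq_top_iff]
  intro x _
  induction x using RatFunc.induction_on with
  | f p q hq =>
    have hq' : algebraMap (Polynomial (Fq r)) (L r) q ≠ 0 := RatFunc.algebraMap_ne_zero hq
    let g : Submodule.span (K r) (spanningSet r) →ₗ[K r] Submodule.span (K r) (spanningSet r) :=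
      (LinearMap.mulLeft (K r) (algebraMap (Polynomial (Fq r)) (L r) q)).restrict
        fun y hy => algebraMap_mul_mem_span r q hy
    have hg : Function.Injective g := fun y z hyz =>
      Subtype.ext (mul_left_cancel₀ hq' (congrArg Subtype.val hyz))
    obtain ⟨y, hy⟩ := LinearMap.surjective_of_injective hg
      ⟨algebraMap (Polynomial (Fq r)) (L r) p, by simpa using algebraMap_mul_mem_span r p h1⟩
    have hy' : algebraMap (Polynomial (Fq r)) (L r) q * y =
      algebraMap (Polynomial (Fq r)) (L r) p := congrArg Subtype.val hy
    rw [← hy', mul_div_cancel_left₀ _ hq']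
    exact y.2

instance finiteDimensional_K (r : ℕ) : FiniteDimensional (K r) (L r) := by
  have : Module.Finite (K r) (Submodule.span (K r) (spanningSet r)) :=
    FiniteDimensional.span_of_finite _ ((Set.finite_range _).union (Set.finite_range _))
  rw [span_spanningSet] at this
  exact Module.Finite.equiv Submodule.topEquiv

/-- `σ` as an automorphism of `L` over `K`. -/
def σK (r : ℕ) : L r ≃ₐ[K r] L r :=
  AlgEquiv.ofBijective { σ r with commutes' := fun k => σ_of_mem_K r k.2 }
    (Algebra.IsAlgebraic.algHom_bijective _)

@[simp] theorem σK_apply (r : ℕ) (x : L r) : σK r x = σ r x := rfl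

/-! ### Constants -/

theorem Fq_pow_card (r : ℕ) (hr : r ≠ 0) (a : Fq r) : a ^ 2 ^ r = a := by
  rw [← GaloisField.card 2 r hr]
  have := Fintype.ofFinite (Fq r)
  rw [Nat.card_eq_fintype_card]
  exact FiniteField.pow_card a

theorem pow_pow_eq_self {M : Type*} [Monoid M] {a : M} {n : ℕ} (h : a ^ n = a) (k : ℕ) :
    a ^ n ^ k = a := by
  induction k with
  | zero => simp
  | succ k ih => rw [pow_succ, pow_mul, ih, h]

/-- The fields with `4` and `2 ^ r` elements meet in the prime field: for `r = 2 k + 1`, the power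
`a ^ 2 ^ r` reduces to `a ^ 2`. -/
theorem Fq_sq_eq_of_pow_four {r : ℕ} (hodd : Odd r) {a : Fq r} (h : a ^ 4 = a) : a ^ 2 = a := by
  obtain ⟨k, rfl⟩ := hodd
  have h1 := Fq_pow_card (2 * k + 1) (by omega) a
  rwa [pow_succ, pow_mul, pow_mul, show 2 ^ 2 = 4 from rfl, pow_pow_eq_self h] at h1

theorem Fq_sq_eq_of_pow_sixteen {r : ℕ} (hodd : Odd r) {a : Fq r} (h : a ^ 16 = a) :
    a ^ 2 = a := by
  have h0 : r ≠ 0 := by rintro rfl; exact absurd hodd (by decide)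
  have h1 := Fq_pow_card r h0 a
  obtain ⟨k, hk⟩ | ⟨k, hk⟩ : (∃ k, r = 4 * k + 1) ∨ ∃ k, r = 4 * k + 3 := by
    obtain ⟨m, rfl⟩ := hodd
    rcases Nat.even_or_odd' m with ⟨k, rfl | rfl⟩
    · exact Or.inl ⟨k, by ring⟩
    · exact Or.inr ⟨k, by ring⟩
  · have e : 2 ^ r = 16 ^ k * 2 := by rw [hk, pow_succ, pow_mul]; norm_num
    rwa [e, pow_mul, pow_pow_eq_self h] at h1
  · have e : 2 ^ r = 16 ^ k * 8 := by rw [hk, pow_add, pow_mul]; norm_num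
    rw [e, pow_mul, pow_pow_eq_self h] at h1
    calc a ^ 2 = (a ^ 8) ^ 2 := by rw [h1]
      _ = a := by rw [← pow_mul, h]

theorem exists_Fq_sq_ne {r : ℕ} (hr : 3 ≤ r) : ∃ a : Fq r, a ^ 2 ≠ a := by
  by_contra! h
  have hsub : (Set.univ : Set (Fq r)) ⊆ {0, 1} := fun a _ => by
    have : a * (a - 1) = 0 := by linear_combination h a
    rcases mul_eq_zero.mp this with h | h
    · simp [h]
    · simp [sub_eq_zero.mp h]
  have h1 := Set.ncard_le_ncard hsub
  rw [Set.ncard_univ, GaloisField.card 2 r (by omega)] at h1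
  have h2 := Set.ncard_insert_le (0 : Fq r) {1}
  rw [Set.ncard_singleton] at h2
  have h3 : 2 ^ 3 ≤ 2 ^ r := Nat.pow_le_pow_right (by norm_num) hr
  omega

theorem exists_σ_sq_ne {r : ℕ} (hr : 3 ≤ r) (hodd : Odd r) : ∃ l, σK r (σK r l) ≠ l := by
  obtain ⟨a, ha⟩ := exists_Fq_sq_ne hr
  refine ⟨RatFunc.C a, fun h => ha (Fq_sq_eq_of_pow_four hodd ?_)⟩
  simp only [σK_apply, σ_C] at h
  simpa [← pow_mul] using RatFunc.C_injective h

theorem exists_σ_pow_four_ne {r : ℕ} (hr : 3 ≤ r) (hodd : Odd r) :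
    ∃ l, σK r (σK r (σK r (σK r l))) ≠ l := by
  obtain ⟨a, ha⟩ := exists_Fq_sq_ne hr
  refine ⟨RatFunc.C a, fun h => ha (Fq_sq_eq_of_pow_sixteen hodd ?_)⟩
  simp only [σK_apply, σ_C] at h
  simpa [← pow_mul] using RatFunc.C_injective h

/-! ### The fixed field of `σ` -/

theorem aeval_t_ne_zero {r : ℕ} {p : Polynomial (Fq r)} (hp : p ≠ 0) :
    Polynomial.aeval (t r) p ≠ 0 := by
  rw [t, RatFunc.aeval_X_left_eq_algebraMap]
  exact RatFunc.algebraMap_ne_zero hp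

theorem t_sq_add_one_ne_zero (r : ℕ) : t r ^ 2 + 1 ≠ 0 := by
  have h := aeval_t_ne_zero (r := r) (p := Polynomial.X ^ 2 + 1)
    (by simpa using (Polynomial.monic_X_pow_add_C (1 : Fq r) (n := 2) (by norm_num)).ne_zero)
  simpa using h

theorem t_sq_add_t_add_one_ne_zero (r : ℕ) : t r ^ 2 + t r + 1 ≠ 0 := by
  have h := aeval_t_ne_zero (r := r) (p := Polynomial.X ^ 2 + Polynomial.X + 1)
    (fun h => by
      have := congrArg (fun p => Polynomial.coeff p 2) h
      simp [Polynomial.coeff_one, Polynomial.coeff_X] at this)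
  simpa using h

theorem s_ne_zero (r : ℕ) : s r ≠ 0 := fun h => by
  have := t_mul_t r
  rw [h] at this
  have h2 : (2 : L r) = 0 := CharTwo.two_eq_zero
  exact t_sq_add_one_ne_zero r (by linear_combination this + h2)

theorem σ_t_ne (r : ℕ) : σ r (t r) ≠ t r := fun h => by
  rw [σ_t] at h
  apply s_ne_zero r
  rw [s_eq, h, CharTwo.add_self_eq_zero]

theorem f₀_eq (r : ℕ) : f₀ r = s r / (s r + 1) := by
  have h1 := t_ne_zero r
  have h2 := t_sq_add_t_add_one_ne_zero r
  have h3 : s r + 1 = (t r ^ 2 + t r + 1) / t r := by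
    rw [s_eq]; field_simp; ring
  rw [h3, f₀, s_eq]
  field_simp

theorem f₀_mem_K (r : ℕ) : f₀ r ∈ K r := by
  rw [f₀_eq]
  exact div_mem (s_mem_K r) (add_mem (s_mem_K r) (one_mem _))

@[simp] theorem σ_f₀ (r : ℕ) : σ r (f₀ r) = f₀ r := σ_of_mem_K r (f₀_mem_K r)

theorem f₀_ne_zero (r : ℕ) : f₀ r ≠ 0 :=
  div_ne_zero (t_sq_add_one_ne_zero r) (t_sq_add_t_add_one_ne_zero r)

/-- The trace `∑ σ ^ i` over `i < 2 r`, as a `K`-linear map. -/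
def trσ (r : ℕ) : L r →ₗ[K r] L r :=
  (∑ i ∈ Finset.range r, ((σK r * σK r) ^ i).toLinearMap) ∘ₗ
    (LinearMap.id + (σK r).toLinearMap)

theorem trσ_apply (r : ℕ) (x : L r) :
    trσ r x = ∑ i ∈ Finset.range r, ((σK r * σK r) ^ i) (x + σ r x) := by
  simp [trσ]

theorem trσ_mul (r : ℕ) {y : L r} (hy : σ r y = y) (x : L r) : trσ r (y * x) = y * trσ r x := by
  have h : ∀ i, ((σK r * σK r) ^ i) y = y := fun i => by
    induction i with
    | zero => rfl
    | succ i ih => rw [pow_succ, AlgEquiv.mul_apply, AlgEquiv.mul_apply]; simp [hy, ih]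
  rw [trσ_apply, trσ_apply, Finset.mul_sum]
  refine Finset.sum_congr rfl fun i _ => ?_
  rw [map_mul, hy, ← mul_add, map_mul, h]

theorem σ_sq_pow_C (r i : ℕ) (a : Fq r) :
    ((σK r * σK r) ^ i) (RatFunc.C a) = RatFunc.C (a ^ 4 ^ i) := by
  induction i with
  | zero => simp
  | succ i ih =>
    rw [pow_succ', AlgEquiv.mul_apply, ih, AlgEquiv.mul_apply, σK_apply, σK_apply, σ_C, σ_C]
    congr 1
    ring

theorem σ_sq_pow_t (r i : ℕ) : ((σK r * σK r) ^ i) (t r) = t r := by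
  induction i with
  | zero => rfl
  | succ i ih => rw [pow_succ', AlgEquiv.mul_apply, ih, AlgEquiv.mul_apply]; simp

/-- Raising to the fourth power permutes the summands cyclically, so the sum is fixed by it and lies
in the prime field. -/
theorem sum_pow_four {r : ℕ} (hodd : Odd r) (a : Fq r) :
    (∑ i ∈ Finset.range r, a ^ 4 ^ i) ^ 2 = ∑ i ∈ Finset.range r, a ^ 4 ^ i := by
  apply Fq_sq_eq_of_pow_four hodd
  have h0 : r ≠ 0 := by rintro rfl; exact absurd hodd (by decide)
  have h4 : (∑ i ∈ Finset.range r, a ^ 4 ^ i) ^ 4 = ∑ i ∈ Finset.range r, a ^ 4 ^ (i + 1) := by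
    rw [show 4 = 2 ^ 2 from rfl, sum_pow_char_pow 2 2]
    refine Finset.sum_congr rfl fun i _ => ?_
    rw [← pow_mul]; congr 1
  have hr : a ^ 4 ^ r = a := by
    rw [show 4 = 2 ^ 2 from rfl, ← pow_mul, mul_comm, pow_mul]
    exact pow_pow_eq_self (Fq_pow_card r h0 a) 2
  rw [h4]
  have e1 := Finset.sum_range_succ (fun i => a ^ 4 ^ i) r
  have e2 := Finset.sum_range_succ' (fun i => a ^ 4 ^ i) r
  rw [e1, hr, pow_zero, pow_one] at e2
  exact (add_right_cancel e2).symm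

theorem trσ_C {r : ℕ} (hodd : Odd r) (a : Fq r) : trσ r (RatFunc.C a) = 0 := by
  rw [trσ_apply, σ_C]
  simp only [map_add, σ_sq_pow_C, Finset.sum_add_distrib]
  rw [← map_sum, ← map_sum]
  have : ∑ i ∈ Finset.range r, (a ^ 2) ^ 4 ^ i = ∑ i ∈ Finset.range r, a ^ 4 ^ i := by
    rw [← sum_pow_four hodd a, sum_pow_char 2]
    exact Finset.sum_congr rfl fun i _ => by rw [← pow_mul, ← pow_mul, mul_comm]
  rw [this, CharTwo.add_self_eq_zero]

theorem trσ_C_mul_t {r : ℕ} (hodd : Odd r) (a : Fq r) :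
    trσ r (RatFunc.C a * t r) = RatFunc.C (∑ i ∈ Finset.range r, a ^ 4 ^ i) * s r := by
  rw [trσ_apply, map_mul, σ_C, σ_t]
  simp only [map_add, map_mul, σ_sq_pow_C, σ_sq_pow_t, map_inv₀, Finset.sum_add_distrib]
  rw [← Finset.sum_mul, ← Finset.sum_mul, ← map_sum, ← map_sum]
  have : ∑ i ∈ Finset.range r, (a ^ 2) ^ 4 ^ i = ∑ i ∈ Finset.range r, a ^ 4 ^ i := by
    rw [← sum_pow_four hodd a, sum_pow_char 2]
    exact Finset.sum_congr rfl fun i _ => by rw [← pow_mul, ← pow_mul, mul_comm]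
  rw [this, s_eq, mul_add]

theorem trσ_mem_K {r : ℕ} (hodd : Odd r) (x : L r) : trσ r x ∈ K r := by
  have hx : x ∈ Submodule.span (K r) (spanningSet r) := by
    rw [span_spanningSet]; exact Submodule.mem_top
  induction hx using Submodule.span_induction with
  | mem x hx =>
    rcases hx with ⟨a, rfl⟩ | ⟨a, rfl⟩
    · simp only [trσ_C hodd]; exact zero_mem _
    · simp only [trσ_C_mul_t hodd]
      refine mul_mem ?_ (s_mem_K r)
      have h := sum_pow_four hodd a
      set A := ∑ i ∈ Finset.range r, a ^ 4 ^ i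
      have h' : A * (A - 1) = 0 := by linear_combination h
      rcases mul_eq_zero.mp h' with h | h
      · rw [h, map_zero]; exact zero_mem _
      · rw [sub_eq_zero.mp h, map_one]; exact one_mem _
  | zero => rw [map_zero]; exact zero_mem _
  | add x y _ _ hx hy => rw [map_add]; exact add_mem hx hy
  | smul k x _ hx => rw [map_smul]; exact mul_mem k.2 hx

/-- The trace takes values in `K` and is linear over `σ`-fixed elements. Since `r` is odd, `t` has
trace `s`, so `y s` is a trace and `y = y s / s` lies in `K`. -/
theorem mem_K_of_σ {r : ℕ} (hodd : Odd r) {y : L r} (hy : σ r y = y) : y ∈ K r := by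
  have h := trσ_mem_K hodd (y * t r)
  rw [trσ_mul r hy] at h
  have ht : trσ r (t r) = s r := by
    have := trσ_C_mul_t hodd (r := r) 1
    have hr : ((r : ℕ) : L r) = 1 := by
      obtain ⟨k, hk⟩ := hodd
      have h := congrArg (Nat.cast (R := L r)) hk
      have h2 : (2 : L r) = 0 := CharTwo.two_eq_zero
      push_cast at h
      linear_combination h + (k : L r) * h2
    simpa [hr] using! this
  rw [ht] at h
  simpa [s_ne_zero] using div_mem h (s_mem_K r)

theorem exists_algebraMap_of_σ {r : ℕ} (hodd : Odd r) (l : L r) (h : σK r l = l) :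
    ∃ k, algebraMap (K r) (L r) k = l :=
  ⟨⟨l, mem_K_of_σ hodd h⟩, rfl⟩

theorem t_mem_fixSq (r : ℕ) : t r ∈ fixSq (σK r) := by simp [mem_fixSq]

theorem finrank_fixSq {r : ℕ} (hodd : Odd r) : Module.finrank (K r) (fixSq (σK r)) = 2 := by
  let g : (K r × K r) →ₗ[K r] fixSq (σK r) :=
    { toFun d := ⟨(d.1 : L r) + d.2 * t r, by
        simp [mem_fixSq, σ_of_mem_K r d.1.2, σ_of_mem_K r d.2.2]⟩
      map_add' d d' := Subtype.ext (by simp; ring)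
      map_smul' k d := Subtype.ext (by simp [IntermediateField.smul_def, mul_assoc]) }
  have hst : σ r (t r) - t r ≠ 0 := sub_ne_zero.mpr (σ_t_ne r)
  have hinj : Function.Injective g := by
    rw [injective_iff_map_eq_zero]
    intro d hd
    have h1 : (d.1 : L r) + d.2 * t r = 0 := congrArg Subtype.val hd
    have h2 := congrArg (σ r) h1
    rw [map_add, map_mul, σ_of_mem_K r d.1.2, σ_of_mem_K r d.2.2, map_zero] at h2
    have h3 : (d.2 : L r) * (σ r (t r) - t r) = 0 := by linear_combination h2 - h1
    have h4 := (mul_eq_zero.mp h3).resolve_right hst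
    rw [h4, zero_mul, add_zero] at h1
    exact Prod.ext (Subtype.ext h1) (Subtype.ext h4)
  have hsurj : Function.Surjective g := by
    rintro ⟨x, hx⟩
    have hx' : σ r (σ r x) = x := mem_fixSq.mp hx
    have ht' : σ r (σ r (t r)) = t r := by simp
    -- The coefficient of `t` in `x = p + q t`, found by applying `σ`; numerator and denominator
    -- both change sign under `σ`.
    set q := (σ r x - x) / (σ r (t r) - t r) with hq
    have hσq : σ r q = q := by
      rw [hq, map_div₀, map_sub, map_sub, hx', ht', ← neg_sub, ← neg_sub (σ r (t r)),
        neg_div_neg_eq]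
    have hqe : q * (σ r (t r) - t r) = σ r x - x := div_mul_cancel₀ _ hst
    refine ⟨(⟨x - q * t r, mem_K_of_σ hodd ?_⟩, ⟨q, mem_K_of_σ hodd hσq⟩), Subtype.ext ?_⟩
    · rw [map_sub, map_mul, hσq]
      linear_combination -hqe
    · simp [g]
  rw [← (LinearEquiv.ofBijective g ⟨hinj, hsurj⟩).finrank_eq, Module.finrank_prod,
    Module.finrank_self]

/-! ### `f₀` is not of the form `c σ(c)` -/

section NotNorm

open Polynomial

variable {r : ℕ} {Ω : Type*} [Field Ω] [Algebra (Fq r) Ω] {ω : Ω}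

/-- `X ^ 2 + X + 1` is the minimal polynomial of `ω`: a root in the constants would satisfy `z ^ 4 =
z`, hence `z ^ 2 = z` as `r` is odd, which gives `1 = 0`. So a remainder of degree at most one
vanishing at `ω` is zero. -/
theorem dvd_of_aeval_eq_zero (hodd : Odd r) (hω : ω ^ 2 + ω + 1 = 0) {a : (Fq r)[X]}
    (ha : aeval ω a = 0) : (X ^ 2 + X + 1 : (Fq r)[X]) ∣ a := by
  have hP : (X ^ 2 + X + 1 : (Fq r)[X]).Monic := by monicity!
  have hdeg : (X ^ 2 + X + 1 : (Fq r)[X]).natDegree = 2 := by compute_degree!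
  rw [← Polynomial.modByMonic_eq_zero_iff_dvd hP]
  have hlt : (a %ₘ (X ^ 2 + X + 1)).natDegree < 2 := by
    have := natDegree_modByMonic_lt a hP (fun h => by rw [h] at hdeg; simp at hdeg)
    omega
  obtain ⟨u, v, huv⟩ := exists_eq_X_add_C_of_natDegree_le_one (Nat.lt_succ_iff.mp hlt)
  have h0 : aeval ω (a %ₘ (X ^ 2 + X + 1)) = 0 := by
    have := congrArg (aeval ω) (modByMonic_add_div a (X ^ 2 + X + 1))
    simpa [hω, ha] using this
  rw [huv] at h0 ⊢
  simp only [map_add, map_mul, aeval_C, aeval_X] at h0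
  have hu : u = 0 := by
    by_contra hu
    have h2 : (2 : Fq r) = 0 := CharTwo.two_eq_zero
    have hc : algebraMap (Fq r) Ω (-v / u) = ω := by
      rw [map_div₀, map_neg, div_eq_iff (by simpa using hu)]
      linear_combination -h0
    rw [← hc] at hω
    have hω' : (-v / u) ^ 2 + (-v / u) + 1 = 0 := by
      apply (algebraMap (Fq r) Ω).injective
      simpa using hω
    set z := -v / u
    have h4 : z ^ 2 = z := Fq_sq_eq_of_pow_four hodd (by
      linear_combination (z ^ 2 - z) * hω')
    have : (1 : Fq r) = 0 := by linear_combination hω' - h4 - z * h2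
    exact one_ne_zero this
  simp only [hu, map_zero, zero_mul, zero_add] at h0 ⊢
  have : v = 0 := by simpa using h0
  rw [this, map_zero]

/-- Up to a power of `t`, `σ(a)` is a polynomial, which does not vanish at a cube root of unity
where `a` does not vanish. -/
theorem exists_σ_mul_t_pow (hω : ω ^ 2 + ω + 1 = 0) (a : (Fq r)[X]) :
    ∃ (a' : (Fq r)[X]) (k : ℕ), σ r (algebraMap (Fq r)[X] (L r) a) * t r ^ k =
      algebraMap (Fq r)[X] (L r) a' ∧ (aeval ω a' = 0 → aeval ω a = 0) := by
  set b := a.map (frobenius (Fq r) 2) with hb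
  have hω0 : ω ≠ 0 := by rintro rfl; simp at hω
  have hch : CharP Ω 2 := charP_of_injective_algebraMap (algebraMap (Fq r) Ω).injective 2
  refine ⟨b.reverse, b.natDegree, ?_, fun h => ?_⟩
  · let := invertibleOfNonzero (inv_ne_zero (t_ne_zero r))
    have h := eval₂_reverse_mul_pow (algebraMap (Fq r) (L r)) (t r)⁻¹ b
    rw [invOf_eq_inv, inv_inv] at h
    rw [σ_algebraMap, ← hb, aeval_def, ← h, mul_assoc, ← mul_pow, inv_mul_cancel₀ (t_ne_zero r),
      one_pow, mul_one, ← aeval_def, t, RatFunc.aeval_X_left_eq_algebraMap]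
  · let := invertibleOfNonzero (inv_ne_zero hω0)
    have h' := eval₂_reverse_mul_pow (algebraMap (Fq r) Ω) ω⁻¹ b
    rw [invOf_eq_inv, inv_inv, ← aeval_def, h, zero_mul] at h'
    -- The twisted polynomial `b` evaluated at `ω⁻¹ = ω ^ 2` is the square of the value of `a` at
    -- `ω`.
    have hinv : ω⁻¹ = ω ^ 2 :=
      inv_eq_of_mul_eq_one_right (by linear_combination (ω - 1) * hω)
    rw [hinv, hb, eval₂_map] at h'
    have : aeval ω a ^ 2 = 0 := by
      rw [← frobenius_def, aeval_def, hom_eval₂, ← RingHom.frobenius_comm, frobenius_def, ← h']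
    exact pow_eq_zero_iff (two_ne_zero) |>.mp this

/-- The parity of the valuation at `P = t ^ 2 + t + 1`, in elementary form: with `x = n / d` in
lowest terms, the equation first forces `P` to divide `d`; then one factor `P` cancels and `n`
vanishes at `ω` too, against coprimality. -/
theorem ne_mul_σ (hodd : Odd r) (x : L r) : x * σ r x ≠ f₀ r := by
  intro hx
  obtain ⟨ω, hω⟩ : ∃ ω : AlgebraicClosure (Fq r), ω ^ 2 + ω + 1 = 0 := by
    obtain ⟨ω, hω⟩ := IsAlgClosed.exists_aeval_eq_zero (AlgebraicClosure (Fq r))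
      (X ^ 2 + X + 1 : (Fq r)[X]) (by
        have : (X ^ 2 + X + 1 : (Fq r)[X]).degree = 2 := by compute_degree!
        rw [this]; norm_num)
    exact ⟨ω, by simpa using hω⟩
  have hω0 : ω ≠ 0 := by rintro rfl; simp at hω
  have hω1 : ω ^ 2 + 1 ≠ 0 := fun h => hω0 (by linear_combination hω - h)
  have hinj : Function.Injective (algebraMap (Fq r)[X] (L r)) := RatFunc.algebraMap_injective _
  set n := x.num
  set d := x.denom
  have hd : algebraMap (Fq r)[X] (L r) d ≠ 0 := RatFunc.algebraMap_ne_zero x.denom_ne_zero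
  have hσd : σ r (algebraMap (Fq r)[X] (L r) d) ≠ 0 := by simpa using hd
  have hxe : x = algebraMap (Fq r)[X] (L r) n / algebraMap (Fq r)[X] (L r) d :=
    (RatFunc.num_div_denom x).symm
  have ht := t_ne_zero r
  have hPt := t_sq_add_t_add_one_ne_zero r
  have hXt : algebraMap (Fq r)[X] (L r) X = t r := RatFunc.algebraMap_X
  have key : (t r ^ 2 + t r + 1) * (algebraMap (Fq r)[X] (L r) n * σ r (algebraMap _ _ n)) =
      (t r ^ 2 + 1) * (algebraMap (Fq r)[X] (L r) d * σ r (algebraMap _ _ d)) := by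
    rw [hxe, map_div₀, f₀, div_mul_div_comm, div_eq_div_iff (mul_ne_zero hd hσd) hPt] at hx
    linear_combination hx
  obtain ⟨n', k, hn', hn⟩ := exists_σ_mul_t_pow hω n
  obtain ⟨d', l, hd', hdd⟩ := exists_σ_mul_t_pow hω d
  have hdω : aeval ω d = 0 := by
    have h : (X ^ 2 + X + 1) * (n * n') * X ^ l = (X ^ 2 + 1) * (d * d') * X ^ k := by
      apply hinj
      simp only [map_mul, map_add, map_pow, map_one, ← hn', ← hd', hXt]
      linear_combination t r ^ k * t r ^ l * key
    have h := congrArg (aeval ω) h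
    simp only [map_mul, map_add, map_pow, map_one, aeval_X, hω, zero_mul] at h
    have h : aeval ω d * aeval ω d' = 0 := by simpa [hω0, hω1] using h
    exact (mul_eq_zero.mp h).elim id hdd
  obtain ⟨e, he⟩ := dvd_of_aeval_eq_zero hodd hω hdω
  obtain ⟨e', m, he', hee⟩ := exists_σ_mul_t_pow hω e
  have hnω : aeval ω n = 0 := by
    -- With `d = P e`, the factor `σ(P) = P / t ^ 2` accounts for the extra exponent `2`; one `P`
    -- remains on the right after cancellation.
    have h : n * n' * X ^ (2 + m) = (X ^ 2 + 1) * (X ^ 2 + X + 1) * (e * e') * X ^ k := by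
      apply hinj
      simp only [map_mul, map_add, map_pow, map_one, ← hn', ← he', hXt]
      rw [he] at key
      simp only [map_mul, map_add, map_pow, map_one, hXt, σ_t] at key
      apply mul_left_cancel₀ hPt
      field_simp at key
      linear_combination t r ^ k * t r ^ m * key
    have h := congrArg (aeval ω) h
    simp only [map_mul, map_add, map_pow, map_one, aeval_X, hω, zero_mul, mul_zero] at h
    have h : aeval ω n * aeval ω n' = 0 := by simpa [hω0] using h
    exact (mul_eq_zero.mp h).elim id hn
  obtain ⟨u, v, huv⟩ := RatFunc.isCoprime_num_denom x
  have := congrArg (aeval ω) huv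
  simp only [map_add, map_mul, map_one] at this
  change aeval ω u * aeval ω n + aeval ω v * aeval ω d = 1 at this
  rw [hnω, hdω] at this
  simp at this

end NotNorm

theorem eq_zero_of_norm_eq {r : ℕ} (hodd : Odd r) (b₀ b₁ : L r)
    (h : b₀ * σK r b₀ = f₀ r * (b₁ * σK r b₁)) : b₀ = 0 ∧ b₁ = 0 := by
  rw [σK_apply, σK_apply] at h
  by_cases h1 : b₁ = 0
  · simpa [h1] using h
  · exfalso
    have h1' : σ r b₁ ≠ 0 := by simpa using h1
    apply ne_mul_σ hodd (b₀ / b₁)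
    rw [map_div₀]
    field_simp
    linear_combination h

/-! ### The field `L'` over `K` -/

/-- `L'` as an intermediate field of `L / K`. -/
def LK (r : ℕ) : IntermediateField (K r) (L r) :=
  (L' r).toSubfield.toIntermediateField fun x => K_le_L' r x.2

theorem mem_LK {r : ℕ} {x : L r} : x ∈ LK r ↔ x ∈ L' r := Iff.rfl

theorem C_mem_L' (r : ℕ) (a : Fq r) : RatFunc.C a ∈ L' r := (L' r).algebraMap_mem a

theorem exists_eq_add_mul_t (r : ℕ) (x : L r) : ∃ p ∈ L' r, ∃ q ∈ L' r, p + q * t r = x := by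
  have hx : x ∈ Submodule.span (K r) (spanningSet r) := by
    rw [span_spanningSet]; exact Submodule.mem_top
  induction hx using Submodule.span_induction with
  | mem x hx =>
    rcases hx with ⟨a, rfl⟩ | ⟨a, rfl⟩
    · exact ⟨_, C_mem_L' r a, 0, zero_mem _, by simp⟩
    · exact ⟨0, zero_mem _, _, C_mem_L' r a, by simp⟩
  | zero => exact ⟨0, zero_mem _, 0, zero_mem _, by simp⟩
  | add x y _ _ hx hy =>
    obtain ⟨p, hp, q, hq, rfl⟩ := hx
    obtain ⟨p', hp', q', hq', rfl⟩ := hy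
    exact ⟨p + p', add_mem hp hp', q + q', add_mem hq hq', by ring⟩
  | smul k x _ hx =>
    obtain ⟨p, hp, q, hq, rfl⟩ := hx
    have hk := K_le_L' r k.2
    exact ⟨k * p, mul_mem hk hp, k * q, mul_mem hk hq, by
      rw [IntermediateField.smul_def, smul_eq_mul]; ring⟩

theorem exists_eq_add_mul {r : ℕ} {γ : L r} (hγ : γ ∉ L' r) (x : L r) :
    ∃ p ∈ L' r, ∃ q ∈ L' r, p + γ * q = x := by
  obtain ⟨p, hp, q, hq, rfl⟩ := exists_eq_add_mul_t r x
  obtain ⟨u, hu, v, hv, rfl⟩ := exists_eq_add_mul_t r γ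
  have hv0 : v ≠ 0 := by
    rintro rfl
    exact hγ (by simpa using hu)
  refine ⟨p - q * u / v, sub_mem hp (div_mem (mul_mem hq hu) hv), q / v, div_mem hq hv, ?_⟩
  field_simp
  ring

/-- `L = L' ⊕ γ L'`. -/
def LKProdEquiv {r : ℕ} {γ : L r} (hγ : γ ∉ L' r) : (LK r × LK r) ≃ₗ[K r] L r :=
  LinearEquiv.ofBijective
    { toFun d := (d.1 : L r) + γ * d.2
      map_add' d d' := by simp; ring
      map_smul' k d := by simp }
    (by
      constructor
      · rw [injective_iff_map_eq_zero]
        intro d hd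
        have h1 : (d.1 : L r) + γ * d.2 = 0 := hd
        by_cases h2 : (d.2 : L r) = 0
        · rw [h2, mul_zero, add_zero] at h1
          exact Prod.ext (Subtype.ext h1) (Subtype.ext h2)
        · exfalso
          apply hγ
          have : γ = -d.1 / d.2 := by
            rw [eq_div_iff h2]; linear_combination h1
          rw [this]
          exact div_mem (neg_mem d.1.2) d.2.2
      · intro x
        obtain ⟨p, hp, q, hq, rfl⟩ := exists_eq_add_mul hγ x
        exact ⟨(⟨p, hp⟩, ⟨q, hq⟩), rfl⟩)

/-- The norm to `M` is `x ^ 2`, so by transitivity the norm to `F` is the square of the norm of `x`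
from `M`. -/
theorem isSquare_norm_of_finrank_eq_two {F E : Type*} [Field F] [Field E] [Algebra F E]
    (M : IntermediateField F E) (h2 : Module.finrank M E = 2) (x : M) :
    IsSquare (Algebra.norm F (x : E)) := by
  have h : Algebra.norm M (x : E) = x ^ 2 := by
    rw [← h2]
    exact Algebra.norm_algebraMap x
  rw [← Algebra.norm_norm (S := M), h, map_pow]
  exact ⟨_, sq _⟩

theorem isSquare_norm_of_mem {r : ℕ} (hne : LK r ≠ ⊤) {x : L r} (hx : x ∈ L' r) :
    IsSquare (Algebra.norm (K r) x) := by
  have h2 : Module.finrank (LK r) (L r) = 2 := by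
    have hle : Module.finrank (LK r) (L r) ≤ 2 := by
      have := finrank_le_of_span_eq_top (R := LK r) (v := ![(1 : L r), t r]) (by
        rw [eq_top_iff]
        intro y _
        obtain ⟨p, hp, q, hq, rfl⟩ := exists_eq_add_mul_t r y
        rw [Matrix.range_cons_cons_empty, Submodule.mem_span_pair]
        exact ⟨⟨p, hp⟩, ⟨q, hq⟩, by simp [IntermediateField.smul_def]⟩)
      simpa using this
    have hne1 : Module.finrank (LK r) (L r) ≠ 1 := fun h =>
      hne (IntermediateField.finrank_eq_one_iff_eq_top.mp h)
    have hpos : 0 < Module.finrank (LK r) (L r) := Module.finrank_pos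
    omega
  exact isSquare_norm_of_finrank_eq_two (LK r) h2 ⟨x, hx⟩

/-! ### Coordinates on `R / R f` -/

/-- The action of skew polynomials on `L[x; σ] / (x ^ 2 - f₀)`, in coordinates. -/
def act (r : ℕ) : R r →+* Module.End (K r) (L r × L r) :=
  SkewMonoidAlgebra.liftNCRingHom
    (Algebra.lsmul (K r) (K r) (L r × L r)).toRingHom
    (powersHom _ (phi (σK r) (f₀ r)))
    (by
      intro l n
      induction n using Multiplicative.rec with
      | ofAdd n =>
      have h : ∀ n : ℕ, Algebra.lsmul (K r) (K r) (L r × L r) ((σ r)^[n] l) *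
          phi (σK r) (f₀ r) ^ n =
          phi (σK r) (f₀ r) ^ n * Algebra.lsmul (K r) (K r) (L r × L r) l := fun n => by
        induction n with
        | zero => simp
        | succ n ih =>
          rw [pow_succ', mul_assoc, ← ih, Function.iterate_succ_apply', ← mul_assoc, ← mul_assoc]
          congr 1
          refine LinearMap.ext fun v => ?_
          exact (phi_smul (σK r) (f₀ r) ((σ r)^[n] l) v).symm
      simpa using! h n)

theorem act_C (r : ℕ) (l : L r) (v : L r × L r) : act r (SkewPolynomial.C l) v = l • v := by
  have : act r (SkewPolynomial.C l) = Algebra.lsmul (K r) (K r) (L r × L r) l := by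
    refine (SkewMonoidAlgebra.liftNC_single _ _ _ _).trans ?_
    simp
  rw [this]
  rfl

theorem act_X (r : ℕ) : act r SkewPolynomial.X = phi (σK r) (f₀ r) := by
  refine (SkewMonoidAlgebra.liftNC_single _ _ _ _).trans ?_
  simp

/-- `phi` is built for `x ^ 2 - f₀`, which is `f` in characteristic two. -/
theorem act_f (r : ℕ) : act r (f r) (1, 0) = 0 := by
  rw [f, map_add, map_pow, act_X, LinearMap.add_apply, act_C, pow_two, Module.End.mul_apply]
  ext <;> simp [CharTwo.add_self_eq_zero]

theorem act_lin (r : ℕ) (a b : L r) (v : L r × L r) :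
    act r (lin a b) v = a • v + b • phi (σK r) (f₀ r) v := by
  rw [lin, map_add, map_mul, act_X, LinearMap.add_apply, Module.End.mul_apply, act_C, act_C]

theorem X_mul_C (r : ℕ) (a : L r) :
    (SkewPolynomial.X : R r) * SkewPolynomial.C a = SkewPolynomial.C (σ r a) * SkewPolynomial.X := by
  rw [SkewPolynomial.C_mul_X_eq_monomial, ← SkewPolynomial.monomial_zero_left,
    SkewPolynomial.X_mul_monomial]
  rfl

theorem cls_mul_f (r : ℕ) (p : R r) : cls (p * f r) = 0 :=
  (Submodule.Quotient.mk_eq_zero _).mpr (Submodule.smul_mem _ p (Submodule.mem_span_singleton_self _))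

/-- The class of `b₀ + b₁ x`, as a `K`-linear map in `(b₀, b₁)`. -/
def clsLin (r : ℕ) : L r × L r →ₗ[K r] RmodRf r where
  toFun v := cls (lin v.1 v.2)
  map_add' u v := by
    rw [← map_add]
    congr 1
    simp only [lin, Prod.fst_add, Prod.snd_add, map_add, add_mul]
    abel
  map_smul' k v := by
    change _ = SkewPolynomial.C (k : L r) • cls (lin v.1 v.2)
    rw [← map_smul]
    congr 1
    simp only [lin, Prod.smul_fst, Prod.smul_snd, IntermediateField.smul_def, smul_eq_mul,
      SkewPolynomial.C_mul, mul_add, mul_assoc]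

theorem clsLin_apply (r : ℕ) (v : L r × L r) : clsLin r v = cls (lin v.1 v.2) := rfl

theorem C_smul_clsLin (r : ℕ) (l : L r) (v : L r × L r) :
    (SkewPolynomial.C l : R r) • clsLin r v = clsLin r (l • v) := by
  rw [clsLin_apply, ← map_smul, clsLin_apply]
  congr 1
  simp only [lin, Prod.smul_fst, Prod.smul_snd, smul_eq_mul, SkewPolynomial.C_mul, mul_add,
    mul_assoc]

theorem X_smul_clsLin (r : ℕ) (v : L r × L r) :
    (SkewPolynomial.X : R r) • clsLin r v = clsLin r (phi (σK r) (f₀ r) v) := by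
  have h : (SkewPolynomial.X : R r) * lin v.1 v.2 =
      lin (f₀ r * σ r v.2) (σ r v.1) + SkewPolynomial.C (σ r v.2) * f r := by
    have h2 : (SkewPolynomial.C (f₀ r * σ r v.2) : R r) + SkewPolynomial.C (f₀ r * σ r v.2) = 0 := by
      rw [← map_add, CharTwo.add_self_eq_zero, map_zero]
    have h3 : (SkewPolynomial.C (σ r v.2) : R r) * SkewPolynomial.C (f₀ r) =
        SkewPolynomial.C (f₀ r * σ r v.2) := by rw [← SkewPolynomial.C_mul, mul_comm]
    rw [lin, lin, f, mul_add, mul_add, h3, X_mul_C, ← mul_assoc, X_mul_C, mul_assoc, pow_two]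
    calc _ = (SkewPolynomial.C (σ r v.1) : R r) * SkewPolynomial.X +
          SkewPolynomial.C (σ r v.2) * (SkewPolynomial.X * SkewPolynomial.X) + 0 := by rw [add_zero]
      _ = _ := by rw [← h2]; abel
  rw [clsLin_apply, ← map_smul, smul_eq_mul, h, map_add, cls_mul_f, add_zero]
  rfl

theorem smul_clsLin (r : ℕ) (p : R r) (v : L r × L r) : p • clsLin r v = clsLin r (act r p v) := by
  induction p using SkewPolynomial.induction generalizing v with
  | h0 => simp
  | ha n l q hn _ hq =>
    clear hn
    have hX : ∀ v, (SkewPolynomial.X ^ n : R r) • clsLin r v =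
        clsLin r (act r (SkewPolynomial.X ^ n) v) := fun v => by
      induction n generalizing v with
      | zero => simp
      | succ n ih =>
        rw [pow_succ, mul_smul, X_smul_clsLin, ih, map_mul, Module.End.mul_apply, act_X]
    rw [add_smul, hq, ← SkewPolynomial.C_mul_X_pow_eq_monomial, mul_smul, hX, C_smul_clsLin,
      map_add, map_mul, LinearMap.add_apply, Module.End.mul_apply, act_C, map_add]

/-- The inverse is evaluation of the action at `(1, 0)`, which is killed by `f` and sent to `v` by
`lin v.1 v.2`. -/
theorem clsLin_bijective (r : ℕ) : Function.Bijective (clsLin r) := by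
  constructor
  · rw [injective_iff_map_eq_zero]
    intro v hv
    rw [clsLin_apply] at hv
    obtain ⟨p, hp⟩ := Submodule.mem_span_singleton.mp ((Submodule.Quotient.mk_eq_zero _).mp hv)
    have h := act_lin r v.1 v.2 (1, 0)
    rw [← hp, smul_eq_mul, map_mul, Module.End.mul_apply, act_f, map_zero] at h
    have h1 := congrArg Prod.fst h
    have h2 := congrArg Prod.snd h
    simp at h1 h2
    exact Prod.ext h1.symm h2.symm
  · intro q
    obtain ⟨p, rfl⟩ := Submodule.mkQ_surjective _ q
    refine ⟨act r p (1, 0), ?_⟩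
    rw [← smul_clsLin, clsLin_apply, ← map_smul]
    change cls _ = cls p
    congr 1
    simp [lin, SkewPolynomial.C_1]

/-- `R / R f` in coordinates. -/
def clsEquiv (r : ℕ) : (L r × L r) ≃ₗ[K r] RmodRf r :=
  LinearEquiv.ofBijective (clsLin r) (clsLin_bijective r)

theorem cls_mul_lin (r : ℕ) (p : R r) (v : L r × L r) :
    cls (p * lin v.1 v.2) = clsEquiv r (act r p v) := by
  rw [← smul_eq_mul, map_smul]
  exact smul_clsLin r p v

/-- Transport of a multiplication along a linear equivalence. -/
theorem existsUnique_transport {F A B : Type*} [Field F] [AddCommGroup A] [Module F A]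
    [AddCommGroup B] [Module F B] (e : A ≃ₗ[F] B) (m : A →ₗ[F] A →ₗ[F] A) :
    ∃! m' : B →ₗ[F] B →ₗ[F] B, ∀ a v, m' (e a) (e v) = e (m a v) := by
  refine ⟨(m.compl₁₂ e.symm.toLinearMap e.symm.toLinearMap).compr₂ e.toLinearMap, ?_, ?_⟩
  · intro a v
    simp
  · intro m' h
    refine LinearMap.ext₂ fun x y => ?_
    have := h (e.symm x) (e.symm y)
    simpa using this

/-! ### The three multiplications in coordinates -/

theorem act_lin_add_C_mul_f (r : ℕ) (u l w : L r) (v : L r × L r) :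
    act r (lin u l + SkewPolynomial.C w * f r) v =
      (u + f₀ r * w) • v + l • phi (σK r) (f₀ r) v +
        w • phi (σK r) (f₀ r) (phi (σK r) (f₀ r) v) := by
  rw [map_add, LinearMap.add_apply, act_lin, map_mul, Module.End.mul_apply, act_C, f, map_add,
    LinearMap.add_apply, map_pow, act_X, act_C, pow_two, Module.End.mul_apply, smul_add, smul_smul,
    add_smul, mul_comm w]
  abel

theorem isPetit_iff {r : ℕ} {m : RmodRf r →ₗ[K r] RmodRf r →ₗ[K r] RmodRf r} :
    IsPetit r m ↔ ∀ a v, m (clsEquiv r a) (clsEquiv r v) =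
      clsEquiv r (twistMul (σK r) (f₀ r) LinearMap.id 0 a v) := by
  have h : ∀ a₀ a₁ b₀ b₁ : L r, cls (lin a₀ a₁ * lin b₀ b₁) =
      clsEquiv r (twistMul (σK r) (f₀ r) LinearMap.id 0 (a₀, a₁) (b₀, b₁)) :=
    fun a₀ a₁ b₀ b₁ => by
      rw [cls_mul_lin r _ (b₀, b₁), act_lin, twistMul_apply]
      simp
  constructor
  · rintro hm ⟨a₀, a₁⟩ ⟨b₀, b₁⟩
    exact (hm a₀ a₁ b₀ b₁).trans (h _ _ _ _)
  · intro hm a₀ a₁ b₀ b₁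
    exact (hm (a₀, a₁) (b₀, b₁)).trans (h _ _ _ _).symm

/-- The constant coefficient of the representative in the definition of `⋆_S`. -/
def αS (r : ℕ) (η : L r) : L r →ₗ[K r] L r := LinearMap.mulLeft (K r) (1 - η * f₀ r)⁻¹

/-- The quadratic coefficient of the representative in the definition of `⋆_S`. -/
def βS (r : ℕ) (η : L r) : L r →ₗ[K r] L r := LinearMap.mulLeft (K r) η ∘ₗ αS r η

theorem αS_apply (r : ℕ) (η a : L r) : αS r η a = (1 - η * f₀ r)⁻¹ * a := rfl

theorem βS_apply (r : ℕ) (η a : L r) : βS r η a = η * αS r η a := rfl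

theorem isStarS_iff {r : ℕ} {η : L r} (hη : 1 - η * f₀ r ≠ 0)
    {m : RmodRf r →ₗ[K r] RmodRf r →ₗ[K r] RmodRf r} :
    IsStarS r η m ↔ ∀ a v, m (clsEquiv r a) (clsEquiv r v) =
      clsEquiv r (twistMul (σK r) (f₀ r) (αS r η) (βS r η) a v) := by
  have h : ∀ a₀ a₁ b₀ b₁ : L r,
      cls ((lin (a₀ - η * a₀ * f₀ r) a₁ + SkewPolynomial.C (η * a₀) * f r) * lin b₀ b₁) =
      clsEquiv r (twistMul (σK r) (f₀ r) (αS r η) (βS r η) (a₀ - η * a₀ * f₀ r, a₁) (b₀, b₁)) :=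
    fun a₀ a₁ b₀ b₁ => by
      have h1 : αS r η (a₀ - η * a₀ * f₀ r) = a₀ := by
        rw [αS_apply, inv_mul_eq_iff_eq_mul₀ hη]; ring
      rw [cls_mul_lin r _ (b₀, b₁), act_lin_add_C_mul_f, twistMul_apply, βS_apply, h1]
      congr 4
      ring
  constructor
  · rintro hm ⟨u, a₁⟩ ⟨b₀, b₁⟩
    have hu : (1 - η * f₀ r)⁻¹ * u - η * ((1 - η * f₀ r)⁻¹ * u) * f₀ r = u := by
      field_simp
    have := (hm ((1 - η * f₀ r)⁻¹ * u) a₁ b₀ b₁).trans (h _ _ _ _)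
    rwa [hu] at this
  · intro hm a₀ a₁ b₀ b₁
    exact (hm (_, a₁) (b₀, b₁)).trans (h _ _ _ _).symm

section StarD

variable {r : ℕ} {γ : L r} (hγ : γ ∉ L' r)

/-- The constant coefficient of the representative in the definition of `⋆_D`. -/
def αD : L r →ₗ[K r] L r :=
  (LK r).val.toLinearMap ∘ₗ LinearMap.fst _ _ _ ∘ₗ (LKProdEquiv hγ).symm.toLinearMap

/-- The quadratic coefficient of the representative in the definition of `⋆_D`. -/
def βD : L r →ₗ[K r] L r :=
  LinearMap.mulLeft (K r) (γ / f₀ r) ∘ₗ (LK r).val.toLinearMap ∘ₗ LinearMap.snd _ _ _ ∘ₗ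
    (LKProdEquiv hγ).symm.toLinearMap

theorem αD_apply {p q : L r} (hp : p ∈ L' r) (hq : q ∈ L' r) : αD hγ (p + γ * q) = p := by
  have : (LKProdEquiv hγ).symm (p + γ * q) = (⟨p, hp⟩, ⟨q, hq⟩) := by
    rw [LinearEquiv.symm_apply_eq]; rfl
  simp [αD, this]

theorem βD_apply {p q : L r} (hp : p ∈ L' r) (hq : q ∈ L' r) :
    βD hγ (p + γ * q) = γ / f₀ r * q := by
  have : (LKProdEquiv hγ).symm (p + γ * q) = (⟨p, hp⟩, ⟨q, hq⟩) := by
    rw [LinearEquiv.symm_apply_eq]; rfl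
  simp [βD, this]

theorem isStarD_iff {m : RmodRf r →ₗ[K r] RmodRf r →ₗ[K r] RmodRf r} :
    IsStarD r γ m ↔ ∀ a v, m (clsEquiv r a) (clsEquiv r v) =
      clsEquiv r (twistMul (σK r) (f₀ r) (αD hγ) (βD hγ) a v) := by
  have h : ∀ p ∈ L' r, ∀ q ∈ L' r, ∀ a₁ b₀ b₁ : L r,
      cls ((lin (p + γ * q) a₁ - SkewPolynomial.C (γ / f₀ r * q) * f r) * lin b₀ b₁) =
      clsEquiv r (twistMul (σK r) (f₀ r) (αD hγ) (βD hγ) (p + γ * q, a₁) (b₀, b₁)) :=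
    fun p hp q hq a₁ b₀ b₁ => by
      have hf := f₀_ne_zero r
      rw [sub_eq_add_neg, ← neg_mul, ← map_neg, cls_mul_lin r _ (b₀, b₁), act_lin_add_C_mul_f,
        twistMul_apply, αD_apply hγ hp hq, βD_apply hγ hp hq, CharTwo.neg_eq]
      congr 4
      have h2 : (2 : L r) = 0 := CharTwo.two_eq_zero
      field_simp
      linear_combination γ * q * h2
  constructor
  · rintro hm ⟨u, a₁⟩ ⟨b₀, b₁⟩
    obtain ⟨p, hp, q, hq, rfl⟩ := exists_eq_add_mul hγ u
    exact (hm p hp q hq a₁ b₀ b₁).trans (h p hp q hq _ _ _)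
  · intro hm p hp q hq a₁ b₀ b₁
    exact (hm (_, a₁) (b₀, b₁)).trans (h p hp q hq _ _ _).symm

theorem αD_add_mul_βD (a : L r) : αD hγ a + f₀ r * βD hγ a = a := by
  obtain ⟨p, hp, q, hq, rfl⟩ := exists_eq_add_mul hγ a
  have hf := f₀_ne_zero r
  rw [αD_apply hγ hp hq, βD_apply hγ hp hq]
  field_simp

theorem αD_one : αD hγ 1 = 1 := by
  simpa using αD_apply hγ (one_mem _) (zero_mem _)

theorem βD_one : βD hγ 1 = 0 := by
  simpa using βD_apply hγ (one_mem _) (zero_mem _)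

/-- For `a = p + γ q` with `q ≠ 0`, equality would make the norm of `γ` the quotient of the norms of
`p` and `q`; these are squares because `p` and `q` lie in `L'`, of index two. -/
theorem norm_αD_ne (hne : LK r ≠ ⊤) (hγN : ¬ IsSquare (Algebra.norm (K r) γ)) {a : L r}
    (ha : a ≠ 0) :
    Algebra.norm (K r) (αD hγ a) ≠ Algebra.norm (K r) (-(βD hγ a * f₀ r)) := by
  obtain ⟨p, hp, q, hq, rfl⟩ := exists_eq_add_mul hγ a
  have hf := f₀_ne_zero r
  rw [αD_apply hγ hp hq, βD_apply hγ hp hq, CharTwo.neg_eq,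
    show γ / f₀ r * q * f₀ r = γ * q by field_simp, map_mul]
  intro h
  by_cases hq0 : q = 0
  · rw [hq0, Algebra.norm_zero, mul_zero, Algebra.norm_eq_zero_iff] at h
    exact ha (by simp [h, hq0])
  · have hn : Algebra.norm (K r) q ≠ 0 := Algebra.norm_ne_zero_iff.mpr hq0
    have e : Algebra.norm (K r) γ = Algebra.norm (K r) p / Algebra.norm (K r) q := by
      rw [h, mul_div_cancel_right₀ _ hn]
    apply hγN
    rw [e]
    exact (isSquare_norm_of_mem hne hp).div (isSquare_norm_of_mem hne hq)

end StarD

theorem αS_add_mul_βS {r : ℕ} {η : L r} (hη : 1 - η * f₀ r ≠ 0) (a : L r) :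
    αS r η a + f₀ r * βS r η a = a := by
  have h2 : (2 : L r) = 0 := CharTwo.two_eq_zero
  rw [βS_apply, αS_apply]
  field_simp
  linear_combination a * η * f₀ r * h2

theorem norm_αS_ne {r : ℕ} {η : L r} (hη : 1 - η * f₀ r ≠ 0)
    (hN : Algebra.norm (K r) (η * f₀ r) ≠ 1) {a : L r} (ha : a ≠ 0) :
    Algebra.norm (K r) (αS r η a) ≠ Algebra.norm (K r) (-(βS r η a * f₀ r)) := by
  have h0 : αS r η a ≠ 0 := mul_ne_zero (inv_ne_zero hη) ha
  rw [βS_apply, CharTwo.neg_eq, mul_right_comm, map_mul]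
  intro h
  exact hN (mul_right_cancel₀ (Algebra.norm_ne_zero_iff.mpr h0) (by rw [← h, one_mul]))

/-! ### Properties common to the multiplications -/

section Common

variable {r : ℕ} {α β : L r →ₗ[K r] L r}

theorem twistMul_isDivisionAlgebra (hodd : Odd r)
    (hN : ∀ a, a ≠ 0 → Algebra.norm (K r) (α a) ≠ Algebra.norm (K r) (-(β a * f₀ r))) :
    IsDivisionAlgebra (twistMul (σK r) (f₀ r) α β) :=
  isDivisionAlgebra_of_noZeroDivisors
    (twistMul_noZeroDivisors (f₀_ne_zero r) (σ_f₀ r) (eq_zero_of_norm_eq hodd) hN)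

/-- Dimension four would give `L` dimension two over `K`, equal to that of `fixSq`, and `σ ^ 2`
would be trivial. This rules out that the nucleus is the whole algebra. -/
theorem finrank_RmodRf_ne (hr : 3 ≤ r) (hodd : Odd r) : Module.finrank (K r) (RmodRf r) ≠ 4 := by
  rw [← (clsEquiv r).finrank_eq, Module.finrank_prod]
  intro h
  have htop : fixSq (σK r) = ⊤ := Submodule.eq_top_of_finrank_eq (by
    rw [finrank_fixSq hodd]; omega)
  obtain ⟨l, hl⟩ := exists_σ_sq_ne hr hodd
  exact hl (mem_fixSq.mp (htop ▸ Submodule.mem_top))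

theorem isCentralDivision_of_transport (hr : 3 ≤ r) (hodd : Odd r) (h1 : ∃ a, α a = 1)
    (hαβ : ∀ a, α a + f₀ r * β a = a)
    (hN : ∀ a, a ≠ 0 → Algebra.norm (K r) (α a) ≠ Algebra.norm (K r) (-(β a * f₀ r)))
    {m : RmodRf r →ₗ[K r] RmodRf r →ₗ[K r] RmodRf r}
    (hm : ∀ a v, m (clsEquiv r a) (clsEquiv r v) = clsEquiv r (twistMul (σK r) (f₀ r) α β a v)) :
    IsCentralDivisionOfDegree m (rightNucleus m) 2 := by
  have hiso : KIsotopic (twistMul (σK r) (f₀ r) α β) m :=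
    ⟨clsEquiv r, clsEquiv r, clsEquiv r, fun a v => (hm a v).symm⟩
  refine rightNucleus_isCentralDivision (f₀_ne_zero r) (σ_f₀ r) (eq_zero_of_norm_eq hodd)
    (exists_algebraMap_of_σ hodd) (exists_σ_sq_ne hr hodd) ⟨t r, t_mem_fixSq r, σ_t_ne r⟩
    (finrank_fixSq hodd) h1 ((twistMul_isDivisionAlgebra hodd hN).of_isotopic hiso)
    (e := clsEquiv r (1, 0)) (fun b => ?_) (clsEquiv r) (clsEquiv r) (clsEquiv r)
    (fun a v => (hm a v).symm) fun T _ b => rfl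
  obtain ⟨a, rfl⟩ := (clsEquiv r).surjective b
  rw [hm, twistMul_one hαβ]

theorem isCentralDivision_of_unital_isotope (hr : 3 ≤ r) (hodd : Odd r) (h1 : ∃ a, α a = 1)
    (hN : ∀ a, a ≠ 0 → Algebra.norm (K r) (α a) ≠ Algebra.norm (K r) (-(β a * f₀ r)))
    {B : Type*} [AddCommGroup B] [Module (K r) B] {m : B →ₗ[K r] B →ₗ[K r] B} (hu : IsUnital m)
    (hiso : KIsotopic (twistMul (σK r) (f₀ r) α β) m) :
    IsCentralDivisionOfDegree m (rightNucleus m) 2 := by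
  have hdiv := (twistMul_isDivisionAlgebra hodd hN).of_isotopic hiso
  obtain ⟨e, he⟩ := hu
  obtain ⟨h₁, h₂, h₃, h⟩ := hiso
  refine rightNucleus_isCentralDivision (f₀_ne_zero r) (σ_f₀ r) (eq_zero_of_norm_eq hodd)
    (exists_algebraMap_of_σ hodd) (exists_σ_sq_ne hr hodd) ⟨t r, t_mem_fixSq r, σ_t_ne r⟩
    (finrank_fixSq hodd) h1 hdiv (e := e) (fun b => (he b).2) h₁ h₂ h₃ h fun T hT b => ?_
  -- Left multiplication by the identity of `m` shows that `h₃` is `h₁` after an operator of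
  -- `twistMul`. Operators commute with the commutant, so conjugation by `h₁` and by `h₃` agree on
  -- it.
  have hid : ∀ v, h₁ (twistMul (σK r) (f₀ r) α β (h₂.symm e) v) = h₃ v := fun v => by
    rw [h, LinearEquiv.apply_symm_apply, (he _).1]
  have hb : h₁.symm b = twistMul (σK r) (f₀ r) α β (h₂.symm e) (h₃.symm b) := by
    rw [LinearEquiv.symm_apply_eq, hid, LinearEquiv.apply_symm_apply]
  rw [hb, twistMul_commute_of_mem hT, hid]

end Common

end

end SkewQuotient

/-! ### Assembly of the theorem. -/

theorem mainTheorem10 (r : ℕ) (hr : 3 ≤ r) (hodd : Odd r) (η γ : L r)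
    (hη : Algebra.norm (K r) (η * f₀ r) ≠ 1)
    (hγ : γ / f₀ r ∉ L' r) (hγN : ¬ IsSquare (Algebra.norm (K r) γ)) :
    (∃! m, IsStarS r η m) ∧ (∃! m, IsStarD r γ m) ∧ (∃! m, IsPetit r m) ∧
    ∀ mS mD mP : RmodRf r →ₗ[K r] RmodRf r →ₗ[K r] RmodRf r,
      IsStarS r η mS → IsStarD r γ mD → IsPetit r mP →
        (IsDivisionAlgebra mS ∧ ¬ IsAssociative mS) ∧
        (IsDivisionAlgebra mD ∧ ¬ IsAssociative mD) ∧
        (IsCentralDivisionOfDegree mS (rightNucleus mS) 2 ∧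
          ∃ x ∈ rightNucleus mS, ∃ y ∈ rightNucleus mS, mS x y ≠ mS y x) ∧
        (IsCentralDivisionOfDegree mD (rightNucleus mD) 2 ∧
          ∃ x ∈ rightNucleus mD, ∃ y ∈ rightNucleus mD, mD x y ≠ mD y x) ∧
        (∀ (B : Type*) [AddCommGroup B] [Module (K r) B] (m : B →ₗ[K r] B →ₗ[K r] B),
          IsUnital m → KIsotopic mS m → IsCentralDivisionOfDegree m (rightNucleus m) 2) ∧
        ¬ KIsotopic mS mD ∧
        (η ≠ 0 → ¬ KIsotopic mS mP) ∧
        ¬ KIsotopic mD mP := by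
  have hη' : 1 - η * f₀ r ≠ 0 := fun h => hη (by rw [← sub_eq_zero.mp h, map_one])
  have hγ' : γ ∉ L' r := fun h => hγ (div_mem h (K_le_L' r (f₀_mem_K r)))
  have hne : LK r ≠ ⊤ := fun h => hγ (mem_LK.mp (h ▸ IntermediateField.mem_top))
  have hf := f₀_ne_zero r
  have hσ := exists_σ_sq_ne hr hodd
  refine ⟨by simpa only [isStarS_iff hη'] using existsUnique_transport (clsEquiv r) _,
    by simpa only [isStarD_iff hγ'] using existsUnique_transport (clsEquiv r) _,
    by simpa only [isPetit_iff] using existsUnique_transport (clsEquiv r) _,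
    fun mS mD mP hS hD hP => ?_⟩
  rw [isStarS_iff hη'] at hS
  rw [isStarD_iff hγ'] at hD
  rw [isPetit_iff] at hP
  have isoS : KIsotopic (twistMul (σK r) (f₀ r) (αS r η) (βS r η)) mS :=
    ⟨clsEquiv r, clsEquiv r, clsEquiv r, fun a v => (hS a v).symm⟩
  have isoD : KIsotopic (twistMul (σK r) (f₀ r) (αD hγ') (βD hγ')) mD :=
    ⟨clsEquiv r, clsEquiv r, clsEquiv r, fun a v => (hD a v).symm⟩
  have isoP : KIsotopic (twistMul (σK r) (f₀ r) LinearMap.id 0) mP :=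
    ⟨clsEquiv r, clsEquiv r, clsEquiv r, fun a v => (hP a v).symm⟩
  have hS1 : ∃ a, αS r η a = 1 := ⟨1 - η * f₀ r, inv_mul_cancel₀ hη'⟩
  have hNS := fun a (ha : a ≠ 0) => norm_αS_ne hη' hη ha
  have hND := fun a (ha : a ≠ 0) => norm_αD_ne hγ' hne hγN ha
  have cS := isCentralDivision_of_transport hr hodd hS1 (αS_add_mul_βS hη') hNS hS
  have cD := isCentralDivision_of_transport hr hodd ⟨1, αD_one hγ'⟩ (αD_add_mul_βD hγ') hND hD
  have hαD : ∀ a, αD hγ' a ∈ LK r := fun a => by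
    obtain ⟨p, hp, q, hq, rfl⟩ := exists_eq_add_mul hγ' a
    rw [αD_apply hγ' hp hq]; exact hp
  have hβD : ∀ a, ∃ w ∈ LK r, βD hγ' a = γ / f₀ r * w := fun a => by
    obtain ⟨p, hp, q, hq, rfl⟩ := exists_eq_add_mul hγ' a
    exact ⟨q, hq, βD_apply hγ' hp hq⟩
  have hD1 : ∃ a, αD hγ' a = 1 ∧ βD hγ' a = 0 := ⟨1, αD_one hγ', βD_one hγ'⟩
  have hrk := finrank_RmodRf_ne hr hodd
  refine ⟨⟨(twistMul_isDivisionAlgebra hodd hNS).of_isotopic isoS, cS.not_isAssociative hrk⟩,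
    ⟨(twistMul_isDivisionAlgebra hodd hND).of_isotopic isoD, cD.not_isAssociative hrk⟩,
    ⟨cS, cS.exists_not_commute⟩, ⟨cD, cD.exists_not_commute⟩,
    fun B _ _ m hu hm => isCentralDivision_of_unital_isotope hr hodd hS1 hNS hu (isoS.trans hm),
    fun h => ?_, fun hη0 h => ?_, fun h => ?_⟩
  · refine not_isotopic_of_left hf hσ (fun l a => ?_) (fun l a => ?_) (LK r) hne (γ / f₀ r)
      hαD hβD hD1 ((isoS.trans h).trans isoD.symm)
    · rw [αS_apply, αS_apply]; ring
    · rw [βS_apply, βS_apply, αS_apply, αS_apply]; ring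
  -- The witness is `(a₀ + a₁ x) l = a₀ l + a₁ σ(l) x`: the Petit operators are stable under right
  -- multiplication by `L`.
  · refine not_isotopic_of_right hf (σ_f₀ r) hσ (exists_σ_pow_four_ne hr hodd) hη0
      (fun l a => ⟨(a.1 * l, a.2 * σ r l), fun v => ?_⟩) hS1 (βS_apply r η)
      ((isoP.trans h.symm).trans isoS.symm)
    simp [twistMul_apply, phi_smul, smul_smul, -phi_apply]
  · exact not_isotopic_of_left hf hσ (fun l a => rfl) (fun l a => (mul_zero l).symm) (LK r) hne
      (γ / f₀ r) hαD hβD hD1 ((isoP.trans h.symm).trans isoD.symm)
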